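/- Let $n\ge 0$, let $\mathcal{O}=\mathbb{C}\{x_0,\dots,x_n\}$ be the ring of convergent power series, with maximal ideal $\mathfrak{m}=\langle x_0,\dots,x_n\rangle$, and let $f\in\mathfrak{m}^2$ be a reduced equation of a hypersurface germ $D=\{f=0\}\subseteq(\mathbb{C}^{n+1},0)$ with an isolated singularity, i.e. the singular locus of $D$, defined by $f$ and its partial derivatives $\partial_0 f,\dots,\partial_n f$ (where $\partial_i=\partial/\partial x_i$), is the origin. Let $\mathrm{Der}=\mathrm{Der}_{\mathbb{C}}(\mathcal{O})$ and let $\mathrm{Der}(-\log D)=\{\delta\in\mathrm{Der}\mid\delta(f)\in\mathcal{O}f\}$ be the $\mathcal{O}$-module of logarithmic vector fields along $D$. Call $D$ quasihomogeneous if, after a holomorphic change of coordinates, $D$ is defined by a polynomial that is weighted homogeneous with respect to some positive integer weights; equivalently, there are a unit $u\in\mathcal{O}^*$ and a $\mathbb{C}$-algebra automorphism $\varphi$ of $\mathcal{O}$ such that $\varphi(uf)$ is such a polynomial. If $D$ is not quasihomogeneous, then every $\delta\in\mathrm{Der}(-\log D)$ lies in $\mathfrak{m}\,\mathrm{Der}$,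 and its linear part $\delta_0\in\mathfrak{m}\,\mathrm{Der}/\mathfrak{m}^2\,\mathrm{Der}\cong\mathfrak{gl}_{n+1}(\mathbb{C})$ satisfies $\mathrm{tr}(\delta_0)=0$. Here, for $\delta=\sum_i g_i\partial_i\in\mathfrak{m}\,\mathrm{Der}$, $\delta_0$ is the matrix $\left(\frac{\partial g_i}{\partial x_j}(0)\right)_{i,j}$. -/

import Mathlib

noncomputable section

namespace LogVF

/-- A formal power series over `ℂ` in the variables `x_0, …, x_n` is convergent if it converges
absolutely on some polydisc of positive radius around the origin. -/
def IsConvergent {n : ℕ} (f : MvPowerSeries (Fin (n + 1)) ℂ) : Prop :=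
  ∃ r : ℝ, 0 < r ∧
    Summable fun m : Fin (n + 1) →₀ ℕ => ‖MvPowerSeries.coeff m f‖ * r ^ m.degree

theorem IsConvergent.of_le {n : ℕ} {f : MvPowerSeries (Fin (n + 1)) ℂ} {r s : ℝ} (hs : 0 < s)
    (hsr : s ≤ r)
    (h : Summable fun m : Fin (n + 1) →₀ ℕ => ‖MvPowerSeries.coeff m f‖ * r ^ m.degree) :
    Summable fun m : Fin (n + 1) →₀ ℕ => ‖MvPowerSeries.coeff m f‖ * s ^ m.degree := by
  refine Summable.of_nonneg_of_le (fun m => by positivity) (fun m => ?_) h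
  gcongr

theorem isConvergent_C {n : ℕ} (c : ℂ) :
    IsConvergent (MvPowerSeries.C c : MvPowerSeries (Fin (n + 1)) ℂ) := by
  classical
  refine ⟨1, one_pos, summable_of_ne_finset_zero (s := {0}) fun m hm => ?_⟩
  have hm' : m ≠ 0 := by simpa using hm
  simp [MvPowerSeries.coeff_C, hm']

theorem isConvergent_X {n : ℕ} (i : Fin (n + 1)) :
    IsConvergent (MvPowerSeries.X i : MvPowerSeries (Fin (n + 1)) ℂ) := by
  classical
  refine ⟨1, one_pos, summable_of_ne_finset_zero (s := {Finsupp.single i 1}) fun m hm => ?_⟩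
  have hm' : m ≠ Finsupp.single i 1 := by simpa using hm
  simp [MvPowerSeries.coeff_X, hm']

theorem IsConvergent.add {n : ℕ} {f g : MvPowerSeries (Fin (n + 1)) ℂ}
    (hf : IsConvergent f) (hg : IsConvergent g) : IsConvergent (f + g) := by
  obtain ⟨r, hr, hf⟩ := hf
  obtain ⟨s, hs, hg⟩ := hg
  have ht : 0 < min r s := lt_min hr hs
  refine ⟨min r s, ht, Summable.of_nonneg_of_le (fun m => by positivity) (fun m => ?_)
    ((IsConvergent.of_le ht (min_le_left r s) hf).add
      (IsConvergent.of_le ht (min_le_right r s) hg))⟩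
  rw [map_add, ← add_mul]
  gcongr
  exact norm_add_le _ _

theorem IsConvergent.mul {n : ℕ} {f g : MvPowerSeries (Fin (n + 1)) ℂ}
    (hf : IsConvergent f) (hg : IsConvergent g) : IsConvergent (f * g) := by
  classical
  obtain ⟨r, hr, hf⟩ := hf
  obtain ⟨s, hs, hg⟩ := hg
  have ht : 0 < min r s := lt_min hr hs
  have hf' := IsConvergent.of_le ht (min_le_left r s) hf
  have hg' := IsConvergent.of_le ht (min_le_right r s) hg
  have hmul := hf'.mul_of_nonneg hg' (fun m => by positivity) (fun m => by positivity)
  have h : Summable fun m : Fin (n + 1) →₀ ℕ => ∑ p ∈ Finset.HasAntidiagonal.antidiagonal m,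
      ‖MvPowerSeries.coeff p.1 f‖ * min r s ^ p.1.degree *
        (‖MvPowerSeries.coeff p.2 g‖ * min r s ^ p.2.degree) :=
    summable_sum_mul_antidiagonal_of_summable_mul
      (f := fun m => ‖MvPowerSeries.coeff m f‖ * min r s ^ m.degree)
      (g := fun m => ‖MvPowerSeries.coeff m g‖ * min r s ^ m.degree) hmul
  refine ⟨min r s, ht, Summable.of_nonneg_of_le (fun m => ?_) (fun m => ?_) h⟩
  · exact mul_nonneg (norm_nonneg _) (pow_nonneg ht.le _)
  rw [MvPowerSeries.coeff_mul]
  calc ‖∑ p ∈ Finset.HasAntidiagonal.antidiagonal m, MvPowerSeries.coeff p.1 f * MvPowerSeries.coeff p.2 g‖ *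
        min r s ^ m.degree
      ≤ (∑ p ∈ Finset.HasAntidiagonal.antidiagonal m,
          ‖MvPowerSeries.coeff p.1 f * MvPowerSeries.coeff p.2 g‖) * min r s ^ m.degree := by
        gcongr
        exact norm_sum_le _ _
    _ = ∑ p ∈ Finset.HasAntidiagonal.antidiagonal m, ‖MvPowerSeries.coeff p.1 f‖ * min r s ^ p.1.degree *
          (‖MvPowerSeries.coeff p.2 g‖ * min r s ^ p.2.degree) := by
        rw [Finset.sum_mul]
        refine Finset.sum_congr rfl fun p hp => ?_
        rw [← Finset.HasAntidiagonal.mem_antidiagonal.mp hp, map_add, pow_add, norm_mul]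
        ring

theorem IsConvergent.pderiv {n : ℕ} {f : MvPowerSeries (Fin (n + 1)) ℂ}
    (hf : IsConvergent f) (i : Fin (n + 1)) : IsConvergent (MvPowerSeries.pderiv ℂ i f) := by
  obtain ⟨r, hr, hf⟩ := hf
  have hinj : Function.Injective fun m : Fin (n + 1) →₀ ℕ => m + Finsupp.single i 1 :=
    fun a b hab => add_right_cancel hab
  have h := (hf.comp_injective hinj).mul_right r⁻¹
  refine ⟨r / 2, by positivity,
    Summable.of_nonneg_of_le (fun m => by positivity) (fun m => ?_) h⟩
  have h1 : ((m i : ℝ) + 1) ≤ 2 ^ m.degree := by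
    have h2 : m i + 1 ≤ 2 ^ m.degree :=
      (Nat.succ_le_succ (Finsupp.le_degree i m)).trans (Nat.lt_two_pow_self)
    exact_mod_cast h2
  have h3 : ‖((m i : ℂ) + 1)‖ = (m i : ℝ) + 1 := by
    rw [← Nat.cast_succ, Complex.norm_natCast, Nat.cast_succ]
  simp only [Function.comp_apply]
  rw [MvPowerSeries.coeff_pderiv, norm_mul, h3, map_add, Finsupp.degree_single, pow_succ,
    div_pow]
  calc ‖MvPowerSeries.coeff (m + Finsupp.single i 1) f‖ * ((m i : ℝ) + 1) *
        (r ^ m.degree / 2 ^ m.degree)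
      ≤ ‖MvPowerSeries.coeff (m + Finsupp.single i 1) f‖ * 2 ^ m.degree *
        (r ^ m.degree / 2 ^ m.degree) := by gcongr
    _ = ‖MvPowerSeries.coeff (m + Finsupp.single i 1) f‖ * (r ^ m.degree * r) * r⁻¹ := by
        field_simp

/-- The subalgebra of convergent power series inside `ℂ⟦x_0, …, x_n⟧`. -/
def convergent (n : ℕ) : Subalgebra ℂ (MvPowerSeries (Fin (n + 1)) ℂ) where
  carrier := {f | IsConvergent f}
  mul_mem' := IsConvergent.mul
  add_mem' := IsConvergent.add
  algebraMap_mem' := isConvergent_C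

/-- `𝒪 = ℂ{x_0, …, x_n}`, the local ring of germs of holomorphic functions at `0 ∈ ℂ^{n+1}`. -/
abbrev Germs (n : ℕ) : Type := convergent n

/-- The coordinate function `x_i`. -/
def coord {n : ℕ} (i : Fin (n + 1)) : Germs n := ⟨MvPowerSeries.X i, isConvergent_X i⟩

/-- The value of a germ at the origin. -/
def evalZero (n : ℕ) : Germs n →+* ℂ :=
  (MvPowerSeries.constantCoeff (σ := Fin (n + 1)) (R := ℂ)).comp (convergent n).val.toRingHom

/-- The maximal ideal `𝔪` of germs vanishing at the origin. -/
def maxIdeal (n : ℕ) : Ideal (Germs n) := RingHom.ker (evalZero n)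

instance maxIdeal_isPrime (n : ℕ) : (maxIdeal n).IsPrime := RingHom.ker_isPrime _

/-- `Der = Der_ℂ(𝒪)`, the `𝒪`-module of germs of holomorphic vector fields at the origin. -/
abbrev VectorFields (n : ℕ) : Type := Derivation ℂ (Germs n) (Germs n)

/-- The coordinate vector field `∂_i = ∂/∂x_i`. -/
def partialDer {n : ℕ} (i : Fin (n + 1)) : VectorFields n where
  toFun f := ⟨MvPowerSeries.pderiv ℂ i f.1, f.2.pderiv i⟩
  map_add' f g := Subtype.ext (map_add _ f.1 g.1)
  map_smul' c f := Subtype.ext ((MvPowerSeries.pderiv ℂ i).map_smul c f.1)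
  map_one_eq_zero' := Subtype.ext (MvPowerSeries.pderiv ℂ i).map_one_eq_zero
  leibniz' f g := Subtype.ext ((MvPowerSeries.pderiv ℂ i).leibniz f.1 g.1)

/-- The singular locus of the germ `D = {f = 0}`, as a closed subset of `Spec 𝒪`: the common zero
locus of `f` and of all its partial derivatives. -/
def singularLocus {n : ℕ} (f : Germs n) : Set (PrimeSpectrum (Germs n)) :=
  PrimeSpectrum.zeroLocus ({f} ∪ Set.range fun i => partialDer i f)

/-- The point of `Spec 𝒪` that corresponds to the origin. -/
def origin (n : ℕ) : PrimeSpectrum (Germs n) := ⟨maxIdeal n, maxIdeal_isPrime n⟩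

/-- `f` is a reduced equation of an isolated hypersurface singularity `D = {f = 0}` at the origin:
`𝒪/(f)` is reduced and the singular locus of the germ `D` consists of the origin alone. -/
structure IsIsolatedSingularity {n : ℕ} (f : Germs n) : Prop where
  reduced : IsReduced (Germs n ⧸ Ideal.span {f})
  singularLocus_eq : singularLocus f = {origin n}

/-- The germ `D = {f = 0}` is quasihomogeneous: after a holomorphic change of coordinates (an
automorphism of the `ℂ`-algebra `𝒪`) it has an equation `u f`, with `u` a unit, that is a weighted
homogeneous polynomial with respect to some positive integer weights. -/
def IsQuasihomogeneous {n : ℕ} (f : Germs n) : Prop :=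
  ∃ (φ : Germs n ≃ₐ[ℂ] Germs n) (u : (Germs n)ˣ) (w : Fin (n + 1) → ℕ) (r : ℕ)
    (p : MvPolynomial (Fin (n + 1)) ℂ),
    (∀ i, 0 < w i) ∧ MvPolynomial.IsWeightedHomogeneous w p r ∧
      ((φ (u * f) : Germs n) : MvPowerSeries (Fin (n + 1)) ℂ) = p

/-- `Der(-log D) = {δ ∈ Der | δ(f) ∈ 𝒪 f}`, the `𝒪`-module of logarithmic vector fields along
`D = {f = 0}`. -/
def logDer {n : ℕ} (f : Germs n) : Submodule (Germs n) (VectorFields n) where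
  carrier := {δ | δ f ∈ Ideal.span {f}}
  add_mem' {δ ε} hδ hε := by
    simpa using Ideal.add_mem _ hδ hε
  zero_mem' := by simp
  smul_mem' a δ hδ := by
    simpa using Ideal.mul_mem_left _ a hδ

/-- `Δ = 𝔪 Der`, the vector fields that vanish at the origin. -/
def vanishingDer (n : ℕ) : Submodule (Germs n) (VectorFields n) := maxIdeal n • ⊤

/-- The matrix of the linear part `δ_0` of a vector field `δ = ∑_i g_i ∂_i`, where `g_i = δ(x_i)`:
the `(i, j)` entry is the coefficient of `x_j` in `g_i`. For `δ ∈ 𝔪 Der` this is the class of `δ`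
in `𝔪 Der / 𝔪² Der ≅ 𝔤𝔩_{n+1}(ℂ)`. -/
def linearPart {n : ℕ} (δ : VectorFields n) : Matrix (Fin (n + 1)) (Fin (n + 1)) ℂ :=
  Matrix.of fun i j =>
    MvPowerSeries.coeff (Finsupp.single j 1)
      ((δ (coord i) : Germs n) : MvPowerSeries (Fin (n + 1)) ℂ)

end LogVF

end

/-! Write `δ f = a f`. The Tjurina ideal of `f` is `δ`-stable and contains some `𝔪 ^ N`. If `δ x_i`
were a unit, differentiating a power of `x_i` repeatedly would bring `1` into this ideal; hence `δ`
vanishes at the origin (`logDer_coord_mem`) and acts on each finite-dimensional quotient `𝒪 / 𝔪 ^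
k`. Generalised eigenvectors there provide coordinates with complex weights `w_i` and a unit
multiple of `f` whose monomials of degree below `k` all have weight `a(0)` (`exists_normalForm`,
`IsGen.weight_eq`). The trace of the linear part is `∑ w_i`.

The weights are controlled by counting generators: an ideal inside `𝔪` that contains `𝔪 ^ N` needs
`n + 1` of them (`le_card_of_pow_le_span`). If, in low degree, neither `f` nor any `∂_j f` with `j ∉
Q` has a monomial in the variables of `S` alone, then the `x_i` with `i ∉ S` and the `∂_j f` with `j
∈ Q` generate such an ideal, so `|S| ≤ |Q|` (`card_le_card_of_monomials`).

If `a(0) = 0`, this gives `#{w_i ≥ c} = #{w_i ≤ -c}` for all `c > 0`, for the real and the imaginary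
parts of the weights alike, and therefore `∑ w_i = 0` (`trace_eq_zero`).

If `a(0) ≠ 0`, then `D` is quasihomogeneous (Saito), which is excluded. Scale to `a(0) = 1` and
subtract a field that kills `f`, so that the variables in the quadratic part get weight `1/2`
(`exists_isHalf`). The count then makes all real parts of weights positive (`weight_pos`). A Taylor
polynomial of the new equation is weighted homogeneous, and finite determinacy
(`exists_algEquiv_ofPoly_add`) identifies the equation with it. Finally the real weights are
replaced by positive integers (`exists_nat_weights`). -/

noncomputable section

namespace LogVF

open scoped ENNReal NNReal
open MvPowerSeries

variable {σ τ : Type*}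

/-! ### Weighted norms of power series and substitution -/

/-- The weighted `ℓ¹` norm of a power series on the polydisc of radius `r`. -/
def nrm (r : ℝ≥0) (f : MvPowerSeries σ ℂ) : ℝ≥0∞ :=
  ∑' m : σ →₀ ℕ, ‖coeff m f‖ₑ * (r : ℝ≥0∞) ^ m.degree

/-- A power series converges if its weighted `ℓ¹` norm is finite for some positive radius. -/
def Conv (f : MvPowerSeries σ ℂ) : Prop := ∃ r : ℝ≥0, 0 < r ∧ nrm r f ≠ ⊤

/-- With values in `ℝ≥0∞` sums can be rearranged freely, and convergence becomes finiteness of a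
single number. -/
theorem isConvergent_iff_conv {n : ℕ} (f : MvPowerSeries (Fin (n + 1)) ℂ) :
    IsConvergent f ↔ Conv f := by
  have key : ∀ r : ℝ≥0, (Summable fun m : Fin (n + 1) →₀ ℕ => ‖coeff m f‖ * (r : ℝ) ^ m.degree) ↔
      nrm r f ≠ ⊤ := by
    intro r
    have h : (fun m : Fin (n + 1) →₀ ℕ => ‖coeff m f‖ * (r : ℝ) ^ m.degree) =
        fun m => (((‖coeff m f‖₊ * r ^ m.degree : ℝ≥0)) : ℝ) := by
      ext m; simp
    rw [h, NNReal.summable_coe, ← ENNReal.tsum_coe_ne_top_iff_summable]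
    unfold nrm
    simp [enorm_eq_nnnorm]
  constructor
  · rintro ⟨r, hr, h⟩
    exact ⟨⟨r, hr.le⟩, hr, (key ⟨r, hr.le⟩).1 h⟩
  · rintro ⟨r, hr, h⟩
    exact ⟨r, hr, (key r).2 h⟩

theorem nrm_mono {r s : ℝ≥0} (h : r ≤ s) (f : MvPowerSeries σ ℂ) : nrm r f ≤ nrm s f := by
  unfold nrm
  gcongr

theorem nrm_add_le (r : ℝ≥0) (f g : MvPowerSeries σ ℂ) : nrm r (f + g) ≤ nrm r f + nrm r g := by
  unfold nrm
  rw [← ENNReal.tsum_add]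
  gcongr with m
  rw [map_add, ← add_mul]
  gcongr
  exact enorm_add_le _ _

theorem nrm_neg (r : ℝ≥0) (f : MvPowerSeries σ ℂ) : nrm r (-f) = nrm r f := by
  simp [nrm]

theorem nrm_mul_le (r : ℝ≥0) (f g : MvPowerSeries σ ℂ) : nrm r (f * g) ≤ nrm r f * nrm r g := by
  classical
  unfold nrm
  calc ∑' m : σ →₀ ℕ, ‖coeff m (f * g)‖ₑ * (r : ℝ≥0∞) ^ m.degree
      ≤ ∑' m : σ →₀ ℕ, ∑ p ∈ Finset.HasAntidiagonal.antidiagonal m,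
          (‖coeff p.1 f‖ₑ * (r : ℝ≥0∞) ^ p.1.degree) *
            (‖coeff p.2 g‖ₑ * (r : ℝ≥0∞) ^ p.2.degree) := by
        gcongr with m
        rw [coeff_mul]
        calc _ ≤ (∑ p ∈ Finset.HasAntidiagonal.antidiagonal m, ‖coeff p.1 f * coeff p.2 g‖ₑ) *
              (r : ℝ≥0∞) ^ m.degree := by
                gcongr
                exact enorm_sum_le _ _
          _ = _ := by
            rw [Finset.sum_mul]
            refine Finset.sum_congr rfl fun p hp => ?_
            rw [← Finset.HasAntidiagonal.mem_antidiagonal.mp hp, map_add, pow_add, enorm_mul]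
            ring
    _ = ∑' p : (σ →₀ ℕ) × (σ →₀ ℕ), (‖coeff p.1 f‖ₑ * (r : ℝ≥0∞) ^ p.1.degree) *
            (‖coeff p.2 g‖ₑ * (r : ℝ≥0∞) ^ p.2.degree) := by
        rw [← (Finset.HasAntidiagonal.sigmaAntidiagonalEquivProd (A := σ →₀ ℕ)).tsum_eq,
          ENNReal.tsum_sigma']
        refine tsum_congr fun m => ?_
        exact (Finset.tsum_subtype' (Finset.HasAntidiagonal.antidiagonal m)
          (fun p : (σ →₀ ℕ) × (σ →₀ ℕ) => (‖coeff p.1 f‖ₑ * (r : ℝ≥0∞) ^ p.1.degree) *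
            (‖coeff p.2 g‖ₑ * (r : ℝ≥0∞) ^ p.2.degree))).symm
    _ = _ := by
        rw [ENNReal.tsum_prod (f := fun a b => (‖coeff a f‖ₑ * (r : ℝ≥0∞) ^ a.degree) *
          (‖coeff b g‖ₑ * (r : ℝ≥0∞) ^ b.degree))]
        simp only [ENNReal.tsum_mul_left, ENNReal.tsum_mul_right]

theorem nrm_monomial (r : ℝ≥0) (d : σ →₀ ℕ) (c : ℂ) :
    nrm r (monomial d c) = ‖c‖ₑ * (r : ℝ≥0∞) ^ d.degree := by
  classical
  unfold nrm
  rw [tsum_eq_single d]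
  · simp
  · intro m hm
    simp [coeff_monomial, hm]

theorem nrm_one (r : ℝ≥0) : nrm r (1 : MvPowerSeries σ ℂ) = 1 := by
  rw [← monomial_zero_one, nrm_monomial]; simp

theorem nrm_X (r : ℝ≥0) (i : σ) : nrm r (X i : MvPowerSeries σ ℂ) = r := by
  rw [X, nrm_monomial]; simp

theorem nrm_pow_le (r : ℝ≥0) (f : MvPowerSeries σ ℂ) (k : ℕ) : nrm r (f ^ k) ≤ nrm r f ^ k := by
  induction k with
  | zero => simp [nrm_one]
  | succ k ih =>
    rw [pow_succ, pow_succ]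
    exact (nrm_mul_le _ _ _).trans (by gcongr)

theorem nrm_prod_le {ι : Type*} (r : ℝ≥0) (s : Finset ι) (f : ι → MvPowerSeries σ ℂ) :
    nrm r (∏ i ∈ s, f i) ≤ ∏ i ∈ s, nrm r (f i) := by
  classical
  induction s using Finset.induction_on with
  | empty => simp [nrm_one]
  | insert a s ha ih =>
    rw [Finset.prod_insert ha, Finset.prod_insert ha]
    exact (nrm_mul_le _ _ _).trans (by gcongr)

theorem nrm_sum_le {ι : Type*} (r : ℝ≥0) (s : Finset ι) (f : ι → MvPowerSeries σ ℂ) :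
    nrm r (∑ i ∈ s, f i) ≤ ∑ i ∈ s, nrm r (f i) := by
  classical
  induction s using Finset.induction_on with
  | empty => simp [nrm]
  | insert a s ha ih =>
    rw [Finset.sum_insert ha, Finset.sum_insert ha]
    exact (nrm_add_le _ _ _).trans (by gcongr)

/-- Shrinking the polydisc by the factor `t` shrinks the norm of a series of order `≥ k` by the
factor `t ^ k`. -/
theorem nrm_mul_le_of_order (r t : ℝ≥0) (ht : t ≤ 1) (k : ℕ) (f : MvPowerSeries σ ℂ)
    (hf : (k : ℕ∞) ≤ f.order) : nrm (t * r) f ≤ (t : ℝ≥0∞) ^ k * nrm r f := by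
  unfold nrm
  rw [← ENNReal.tsum_mul_left]
  refine ENNReal.tsum_le_tsum fun m => ?_
  by_cases hm : m.degree < k
  · rw [coeff_of_lt_order (lt_of_lt_of_le (by exact_mod_cast hm) hf)]
    simp
  · rw [ENNReal.coe_mul, mul_pow]
    have h1 : (t : ℝ≥0∞) ^ m.degree ≤ (t : ℝ≥0∞) ^ k :=
      pow_le_pow_right_of_le_one' (by exact_mod_cast ht) (not_lt.mp hm)
    calc _ = (t : ℝ≥0∞) ^ m.degree * (‖coeff m f‖ₑ * (r : ℝ≥0∞) ^ m.degree) := by ring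
      _ ≤ _ := by gcongr

/-- By submultiplicativity a monomial of degree `d` in the `a i` has norm at most `R ^ d`;
exchanging the two summations gives the bound. -/
theorem nrm_subst_le {r R : ℝ≥0} {a : σ → MvPowerSeries τ ℂ} (ha : HasSubst a)
    (h : ∀ i, nrm r (a i) ≤ R) (f : MvPowerSeries σ ℂ) : nrm r (subst a f) ≤ nrm R f := by
  have hmon : ∀ d : σ →₀ ℕ, nrm r (d.prod fun s e => a s ^ e) ≤ (R : ℝ≥0∞) ^ d.degree := by
    intro d
    refine (nrm_prod_le _ _ _).trans ?_
    calc ∏ i ∈ d.support, nrm r (a i ^ d i) ≤ ∏ i ∈ d.support, (R : ℝ≥0∞) ^ d i := by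
          gcongr with i hi
          exact (nrm_pow_le _ _ _).trans (by gcongr; exact h i)
      _ = _ := by rw [Finset.prod_pow_eq_pow_sum]; rfl
  calc nrm r (subst a f) ≤ ∑' e : τ →₀ ℕ, ∑' d : σ →₀ ℕ,
        ‖coeff d f‖ₑ * (‖coeff e (d.prod fun s e => a s ^ e)‖ₑ * (r : ℝ≥0∞) ^ e.degree) := by
        unfold nrm
        gcongr with e
        rw [coeff_subst ha]
        have hfin := coeff_subst_finite ha f e
        rw [finsum_eq_sum _ hfin]
        calc _ ≤ (∑ d ∈ hfin.toFinset, ‖coeff d f • coeff e (d.prod fun s e => a s ^ e)‖ₑ) *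
                (r : ℝ≥0∞) ^ e.degree := by gcongr; exact enorm_sum_le _ _
          _ = ∑ d ∈ hfin.toFinset,
              ‖coeff d f‖ₑ * (‖coeff e (d.prod fun s e => a s ^ e)‖ₑ * (r : ℝ≥0∞) ^ e.degree) := by
              rw [Finset.sum_mul]
              refine Finset.sum_congr rfl fun d _ => ?_
              rw [smul_eq_mul, enorm_mul, mul_assoc]
          _ ≤ _ := ENNReal.sum_le_tsum _
    _ = ∑' d : σ →₀ ℕ, ‖coeff d f‖ₑ * nrm r (d.prod fun s e => a s ^ e) := by
        rw [ENNReal.tsum_comm]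
        simp only [ENNReal.tsum_mul_left]
        rfl
    _ ≤ nrm R f := by
        unfold nrm
        gcongr with d
        exact hmon d

theorem exists_common_radius {ι : Type*} [Finite ι] {a : ι → MvPowerSeries τ ℂ}
    (ha : ∀ i, Conv (a i)) : ∃ r : ℝ≥0, 0 < r ∧ ∃ M : ℝ≥0, ∀ i, nrm r (a i) ≤ M := by
  cases nonempty_fintype ι
  choose r hr har using ha
  obtain ⟨r₀, hr₀, hr₀'⟩ : ∃ r₀ : ℝ≥0, 0 < r₀ ∧ ∀ i, r₀ ≤ r i := by
    rcases isEmpty_or_nonempty ι with h | h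
    · exact ⟨1, one_pos, fun i => h.elim i⟩
    · obtain ⟨i, hi⟩ := Finite.exists_min r
      exact ⟨r i, hr i, hi⟩
  have hfin : ∀ i, nrm r₀ (a i) ≠ ⊤ := fun i =>
    ne_top_of_le_ne_top (har i) (nrm_mono (hr₀' i) _)
  refine ⟨r₀, hr₀, ∑ i, (nrm r₀ (a i)).toNNReal, fun i => ?_⟩
  rw [← ENNReal.coe_toNNReal (hfin i)]
  exact_mod_cast Finset.single_le_sum (f := fun i => (nrm r₀ (a i)).toNNReal)
    (fun _ _ => zero_le) (Finset.mem_univ i)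

theorem exists_nrm_le {ι : Type*} [Finite ι] {a : ι → MvPowerSeries τ ℂ} (ha : ∀ i, Conv (a i))
    (ha0 : ∀ i, constantCoeff (a i) = 0) {R : ℝ≥0} (hR : 0 < R) :
    ∃ r : ℝ≥0, 0 < r ∧ ∀ i, nrm r (a i) ≤ R := by
  obtain ⟨r₀, hr₀, M, hM⟩ := exists_common_radius ha
  -- Series without constant term shrink at least by the factor `t`, so `t * M ≤ R` suffices.
  set t : ℝ≥0 := min 1 (R / (M + 1)) with ht
  have ht0 : 0 < t := lt_min one_pos (by positivity)
  refine ⟨t * r₀, by positivity, fun i => ?_⟩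
  calc nrm (t * r₀) (a i) ≤ (t : ℝ≥0∞) ^ 1 * nrm r₀ (a i) :=
        nrm_mul_le_of_order _ _ (min_le_left _ _) 1 _
          (by exact_mod_cast one_le_order_iff_constCoeff_eq_zero.2 (ha0 i))
    _ ≤ (t : ℝ≥0∞) ^ 1 * M := by gcongr; exact hM i
    _ ≤ R := by
        rw [pow_one]
        have h1 : t * M ≤ R := by
          calc t * M ≤ R / (M + 1) * (M + 1) := by
                gcongr
                · exact min_le_right _ _
                · simp
            _ = R := div_mul_cancel₀ _ (by positivity)
        exact_mod_cast h1

/-- Order two makes the norm decay like the square of the radius, so it drops below half the radius.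
This lets the iteration below preserve a ball. -/
theorem exists_nrm_le_half {ι : Type*} [Finite ι] {u : ι → MvPowerSeries τ ℂ}
    (hu : ∀ i, Conv (u i)) (hu2 : ∀ i, 2 ≤ (u i).order) :
    ∃ R : ℝ≥0, 0 < R ∧ ∀ i, nrm R (u i) ≤ (R / 2 : ℝ≥0) := by
  obtain ⟨r₀, hr₀, M, hM⟩ := exists_common_radius hu
  set t : ℝ≥0 := min 1 (r₀ / (2 * (M + 1))) with ht
  have ht0 : 0 < t := lt_min one_pos (by positivity)
  refine ⟨t * r₀, by positivity, fun i => ?_⟩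
  calc nrm (t * r₀) (u i) ≤ (t : ℝ≥0∞) ^ 2 * nrm r₀ (u i) :=
        nrm_mul_le_of_order _ _ (min_le_left _ _) 2 _ (by exact_mod_cast hu2 i)
    _ ≤ (t : ℝ≥0∞) ^ 2 * M := by gcongr; exact hM i
    _ ≤ (t * r₀ / 2 : ℝ≥0) := by
        have h1 : t * M ≤ r₀ / 2 := by
          calc t * M ≤ r₀ / (2 * (M + 1)) * (M + 1) := by
                gcongr
                · exact min_le_right _ _
                · simp
            _ = r₀ / 2 := by field_simp
        have h2 : t ^ 2 * M ≤ t * r₀ / 2 := by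
          calc t ^ 2 * M = t * (t * M) := by ring
            _ ≤ t * (r₀ / 2) := by gcongr
            _ = _ := by ring
        exact_mod_cast h2

theorem Conv.subst [Finite σ] {a : σ → MvPowerSeries τ ℂ} (ha : ∀ i, Conv (a i))
    (ha0 : ∀ i, constantCoeff (a i) = 0) {f : MvPowerSeries σ ℂ} (hf : Conv f) :
    Conv (MvPowerSeries.subst a f) := by
  obtain ⟨R, hR, hf⟩ := hf
  obtain ⟨r, hr, h⟩ := exists_nrm_le ha ha0 hR
  exact ⟨r, hr, ne_top_of_le_ne_top hf (nrm_subst_le (hasSubst_of_constantCoeff_zero ha0) h f)⟩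

/-! ### Orders of power series and contraction -/

theorem exists_coeff_eq {ι : Type*} (F : ι → (σ →₀ ℕ) → ℂ) :
    ∃ H : ι → MvPowerSeries σ ℂ, ∀ i m, coeff m (H i) = F i m :=
  ⟨F, fun _ _ => coeff_apply _ _⟩

theorem le_order_mul_of_le {a b : ℕ} {f g : MvPowerSeries σ ℂ} (hf : (a : ℕ∞) ≤ f.order)
    (hg : (b : ℕ∞) ≤ g.order) : ((a + b : ℕ) : ℕ∞) ≤ (f * g).order := by
  push_cast
  exact (add_le_add hf hg).trans le_order_mul

theorem le_order_add_of_le {a : ℕ} {f g : MvPowerSeries σ ℂ} (hf : (a : ℕ∞) ≤ f.order)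
    (hg : (a : ℕ∞) ≤ g.order) : (a : ℕ∞) ≤ (f + g).order :=
  (le_min hf hg).trans min_order_le_add

theorem le_order_iff {k : ℕ} {f : MvPowerSeries σ ℂ} :
    (k : ℕ∞) ≤ f.order ↔ ∀ m : σ →₀ ℕ, m.degree < k → coeff m f = 0 :=
  ⟨fun h m hm => coeff_of_lt_order (lt_of_lt_of_le (by exact_mod_cast hm) h), nat_le_order⟩

/-- `A` and `A'` have order at least `k` and agree up to order `d + k - 1`. -/
structure Agree (d k : ℕ) (A A' : MvPowerSeries σ ℂ) : Prop where
  left : (k : ℕ∞) ≤ A.order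
  right : (k : ℕ∞) ≤ A'.order
  sub : ((d + k - 1 : ℕ) : ℕ∞) ≤ (A - A').order

theorem Agree.one (d : ℕ) : Agree d 0 (1 : MvPowerSeries σ ℂ) 1 :=
  ⟨by simp, by simp, by simp⟩

theorem Agree.mul {d k l : ℕ} {A A' B B' : MvPowerSeries σ ℂ} (h : Agree d k A A')
    (h' : Agree d l B B') : Agree d (k + l) (A * B) (A' * B') := by
  refine ⟨le_order_mul_of_le h.left h'.left, le_order_mul_of_le h.right h'.right, ?_⟩
  have e : A * B - A' * B' = (A - A') * B + A' * (B - B') := by ring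
  rw [e]
  refine le_order_add_of_le ?_ ?_
  · exact (by exact_mod_cast (by omega : d + (k + l) - 1 ≤ (d + k - 1) + l) :
      ((d + (k + l) - 1 : ℕ) : ℕ∞) ≤ ((d + k - 1 + l : ℕ) : ℕ∞)).trans
      (le_order_mul_of_le h.sub h'.left)
  · exact (by exact_mod_cast (by omega : d + (k + l) - 1 ≤ k + (d + l - 1)) :
      ((d + (k + l) - 1 : ℕ) : ℕ∞) ≤ ((k + (d + l - 1) : ℕ) : ℕ∞)).trans
      (le_order_mul_of_le h.right h'.sub)

theorem Agree.pow {d k : ℕ} {A A' : MvPowerSeries σ ℂ} (h : Agree d k A A') (e : ℕ) :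
    Agree d (e * k) (A ^ e) (A' ^ e) := by
  induction e with
  | zero => simpa using Agree.one d
  | succ e ih =>
    rw [pow_succ, pow_succ, add_mul, one_mul]
    exact ih.mul h

theorem Agree.prod {d : ℕ} {a b : τ → MvPowerSeries σ ℂ} (h : ∀ i, Agree d 1 (a i) (b i))
    (α : τ →₀ ℕ) : Agree d α.degree (α.prod fun s e => a s ^ e) (α.prod fun s e => b s ^ e) := by
  classical
  have key : ∀ s : Finset τ,
      Agree d (∑ i ∈ s, α i) (∏ i ∈ s, a i ^ α i) (∏ i ∈ s, b i ^ α i) := by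
    intro s
    induction s using Finset.induction_on with
    | empty => simpa using Agree.one d
    | insert i s hi ih =>
      rw [Finset.prod_insert hi, Finset.prod_insert hi, Finset.sum_insert hi]
      have := (h i).pow (α i)
      rw [mul_one] at this
      exact this.mul ih
  exact key α.support

/-- Substitution into a series of order at least two is contracting for the `𝔪`-adic topology. -/
theorem le_order_subst_sub_subst [Finite τ] {d : ℕ} {a b : τ → MvPowerSeries σ ℂ}
    (ha : ∀ i, constantCoeff (a i) = 0) (hb : ∀ i, constantCoeff (b i) = 0)
    (hab : ∀ i, (d : ℕ∞) ≤ (a i - b i).order) {u : MvPowerSeries τ ℂ} (hu : 2 ≤ u.order) :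
    ((d + 1 : ℕ) : ℕ∞) ≤ (subst a u - subst b u).order := by
  rw [le_order_iff]
  intro e he
  rw [map_sub, sub_eq_zero, coeff_subst (hasSubst_of_constantCoeff_zero ha),
    coeff_subst (hasSubst_of_constantCoeff_zero hb)]
  refine finsum_congr fun α => ?_
  by_cases hα : α.degree < 2
  · rw [(le_order_iff (k := 2)).1 (by exact_mod_cast hu) α hα]
    simp
  -- A monomial of degree at least two agrees up to order `d + 2 - 1`, which is the gain of one.
  · have h := (Agree.prod (d := d) (fun i => ⟨by
        exact_mod_cast one_le_order_iff_constCoeff_eq_zero.2 (ha i), by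
        exact_mod_cast one_le_order_iff_constCoeff_eq_zero.2 (hb i), by simpa using hab i⟩) α).sub
    have := le_order_iff.1 h e (by omega)
    rw [map_sub, sub_eq_zero] at this
    rw [this]

theorem constantCoeff_eq_zero_of_two_le_order {u : MvPowerSeries τ ℂ} (hu : 2 ≤ u.order) :
    constantCoeff u = 0 := by
  rw [← one_le_order_iff_constCoeff_eq_zero]
  exact le_trans (by norm_num) hu

/-! ### The implicit function theorem for convergent series -/

/-- The successive approximations to the solution of `ψ = ℓ + u(ψ)`. -/
def approx (ℓ : τ → MvPowerSeries σ ℂ) (u : τ → MvPowerSeries τ ℂ) : ℕ → τ → MvPowerSeries σ ℂ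
  | 0 => fun _ => 0
  | k + 1 => fun i => ℓ i + subst (approx ℓ u k) (u i)

section
variable [Finite τ] {ℓ : τ → MvPowerSeries σ ℂ} {u : τ → MvPowerSeries τ ℂ}

theorem constantCoeff_approx (hℓ : ∀ i, constantCoeff (ℓ i) = 0) (hu : ∀ i, 2 ≤ (u i).order)
    (k : ℕ) (i : τ) : constantCoeff (approx ℓ u k i) = 0 := by
  induction k generalizing i with
  | zero => simp [approx]
  | succ k ih =>
    rw [approx, map_add, hℓ, constantCoeff_subst_eq_zero (hasSubst_of_constantCoeff_zero ih) ih
      (constantCoeff_eq_zero_of_two_le_order (hu i)), add_zero]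

theorem le_order_approx_succ_sub (hℓ : ∀ i, constantCoeff (ℓ i) = 0)
    (hu : ∀ i, 2 ≤ (u i).order) (k : ℕ) (i : τ) :
    (k : ℕ∞) ≤ (approx ℓ u (k + 1) i - approx ℓ u k i).order := by
  induction k generalizing i with
  | zero => simp
  | succ k ih =>
    have e : approx ℓ u (k + 1 + 1) i - approx ℓ u (k + 1) i =
        subst (approx ℓ u (k + 1)) (u i) - subst (approx ℓ u k) (u i) := by
      rw [approx, approx]; ring
    rw [e]
    exact le_order_subst_sub_subst (constantCoeff_approx hℓ hu _) (constantCoeff_approx hℓ hu _)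
      ih (hu i)

theorem le_order_approx_sub (hℓ : ∀ i, constantCoeff (ℓ i) = 0) (hu : ∀ i, 2 ≤ (u i).order)
    {k l : ℕ} (hkl : k ≤ l) (i : τ) :
    (k : ℕ∞) ≤ (approx ℓ u l i - approx ℓ u k i).order := by
  induction l, hkl using Nat.le_induction with
  | base => simp
  | succ l hl ih =>
    have e : approx ℓ u (l + 1) i - approx ℓ u k i =
      (approx ℓ u (l + 1) i - approx ℓ u l i) + (approx ℓ u l i - approx ℓ u k i) := by ring
    rw [e]
    exact le_order_add_of_le ((by exact_mod_cast hl : (k : ℕ∞) ≤ l).trans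
      (le_order_approx_succ_sub hℓ hu l i)) ih

/-- The ball of radius `R` is preserved: `ℓ` contributes at most `R / 2`, and `u` of anything in the
ball at most `R / 2`. -/
theorem nrm_approx_le {r R : ℝ≥0} (hℓ : ∀ i, constantCoeff (ℓ i) = 0)
    (hu : ∀ i, 2 ≤ (u i).order) (hℓr : ∀ i, nrm r (ℓ i) ≤ (R / 2 : ℝ≥0))
    (huR : ∀ i, nrm R (u i) ≤ (R / 2 : ℝ≥0)) (k : ℕ) (i : τ) : nrm r (approx ℓ u k i) ≤ R := by
  induction k generalizing i with
  | zero => simp [approx, nrm]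
  | succ k ih =>
    calc nrm r (approx ℓ u (k + 1) i) ≤ nrm r (ℓ i) + nrm r (subst (approx ℓ u k) (u i)) :=
          nrm_add_le _ _ _
      _ ≤ (R / 2 : ℝ≥0) + (R / 2 : ℝ≥0) := by
          gcongr
          · exact hℓr i
          · exact (nrm_subst_le (hasSubst_of_constantCoeff_zero (constantCoeff_approx hℓ hu k))
              ih _).trans (huR i)
      _ = R := by rw [← ENNReal.coe_add, add_halves]

/-- The implicit function theorem for convergent power series, in fixed point form. -/
theorem exists_conv_fixedPoint (hℓc : ∀ i, Conv (ℓ i)) (hℓ : ∀ i, constantCoeff (ℓ i) = 0)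
    (huc : ∀ i, Conv (u i)) (hu : ∀ i, 2 ≤ (u i).order) :
    ∃ ψ : τ → MvPowerSeries σ ℂ, (∀ i, Conv (ψ i)) ∧ (∀ i, constantCoeff (ψ i) = 0) ∧
      ∀ i, ψ i = ℓ i + subst ψ (u i) := by
  -- Coefficients of degree `d` are stationary from the approximation number `d + 1` on; `ψ`
  -- collects these limits.
  obtain ⟨ψ, hψ⟩ : ∃ ψ : τ → MvPowerSeries σ ℂ,
      ∀ i m, coeff m (ψ i) = coeff m (approx ℓ u (m.degree + 1) i) :=
    exists_coeff_eq fun i m => coeff m (approx ℓ u (m.degree + 1) i)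
  have hψk : ∀ i k m, m.degree < k → coeff m (ψ i) = coeff m (approx ℓ u k i) := by
    intro i k m hm
    have := le_order_iff.1 (le_order_approx_sub hℓ hu (Nat.succ_le_of_lt hm) i) m (by simp)
    rw [map_sub, sub_eq_zero] at this
    rw [hψ, this]
  have hψ0 : ∀ i, constantCoeff (ψ i) = 0 := by
    intro i
    rw [← coeff_zero_eq_constantCoeff_apply, hψ, coeff_zero_eq_constantCoeff_apply]
    exact constantCoeff_approx hℓ hu _ i
  refine ⟨ψ, fun i => ?_, hψ0, fun i => ?_⟩
  · obtain ⟨R, hR, huR⟩ := exists_nrm_le_half huc hu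
    obtain ⟨r, hr, hℓr⟩ := exists_nrm_le hℓc hℓ (half_pos hR)
    refine ⟨r, hr, ne_top_of_le_ne_top (ENNReal.coe_ne_top (r := R)) ?_⟩
    unfold nrm
    rw [ENNReal.tsum_eq_iSup_sum]
    refine iSup_le fun s => ?_
    -- A finite partial sum only sees one approximation of sufficiently high index, so the uniform
    -- bound passes to the limit.
    set k := s.sup Finsupp.degree + 1 with hk
    calc ∑ m ∈ s, ‖coeff m (ψ i)‖ₑ * (r : ℝ≥0∞) ^ m.degree
        = ∑ m ∈ s, ‖coeff m (approx ℓ u k i)‖ₑ * (r : ℝ≥0∞) ^ m.degree := by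
          refine Finset.sum_congr rfl fun m hm => ?_
          rw [hψk i k m (Nat.lt_succ_of_le (Finset.le_sup (f := Finsupp.degree) hm))]
      _ ≤ nrm r (approx ℓ u k i) := ENNReal.sum_le_tsum s
      _ ≤ R := nrm_approx_le hℓ hu hℓr huR k i
  · ext m
    rw [hψk i (m.degree + 1 + 1) m (by omega), approx, map_add, map_add]
    congr 1
    have hj : ∀ j, ((m.degree + 1 : ℕ) : ℕ∞) ≤ (approx ℓ u (m.degree + 1) j - ψ j).order := by
      intro j
      rw [le_order_iff]
      intro e he
      rw [map_sub, sub_eq_zero, hψk j _ e he]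
    have h := le_order_iff.1 (le_order_subst_sub_subst (constantCoeff_approx hℓ hu _) hψ0 hj (hu i))
      m (by omega)
    rwa [map_sub, sub_eq_zero] at h

end

/-! ### Germs: coefficients, values and partial derivatives -/

section

variable {n : ℕ}

theorem conv_coe (g : Germs n) : Conv (g : MvPowerSeries (Fin (n + 1)) ℂ) :=
  (isConvergent_iff_conv _).1 g.2

/-- The germ of a convergent power series. -/
def ofConv {g : MvPowerSeries (Fin (n + 1)) ℂ} (hg : Conv g) : Germs n :=
  ⟨g, (isConvergent_iff_conv _).2 hg⟩

@[simp] theorem coe_ofConv {g : MvPowerSeries (Fin (n + 1)) ℂ} (hg : Conv g) :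
    (ofConv hg : MvPowerSeries (Fin (n + 1)) ℂ) = g := rfl

/-- The coefficient of a germ at a monomial, as a linear form. -/
def cf (m : Fin (n + 1) →₀ ℕ) : Germs n →ₗ[ℂ] ℂ :=
  (coeff m : MvPowerSeries (Fin (n + 1)) ℂ →ₗ[ℂ] ℂ).comp (convergent n).val.toLinearMap

theorem cf_apply (m : Fin (n + 1) →₀ ℕ) (g : Germs n) :
    cf m g = coeff m (g : MvPowerSeries (Fin (n + 1)) ℂ) := rfl

theorem germ_ext {g h : Germs n} (H : ∀ m, cf m g = cf m h) : g = h :=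
  Subtype.ext (MvPowerSeries.ext H)

theorem evalZero_apply (g : Germs n) :
    evalZero n g = constantCoeff (g : MvPowerSeries (Fin (n + 1)) ℂ) := rfl

theorem cf_zero (g : Germs n) : cf 0 g = evalZero n g := by
  rw [cf_apply, evalZero_apply, coeff_zero_eq_constantCoeff_apply]

theorem mem_maxIdeal {g : Germs n} : g ∈ maxIdeal n ↔ evalZero n g = 0 := RingHom.mem_ker

theorem coe_coord (i : Fin (n + 1)) :
    (coord i : MvPowerSeries (Fin (n + 1)) ℂ) = X i := rfl

@[simp] theorem evalZero_coord (i : Fin (n + 1)) : evalZero n (coord i) = 0 := by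
  rw [evalZero_apply, coe_coord]; simp

theorem coord_mem (i : Fin (n + 1)) : coord i ∈ maxIdeal n := mem_maxIdeal.2 (evalZero_coord i)

@[simp] theorem evalZero_algebraMap (c : ℂ) : evalZero n (algebraMap ℂ (Germs n) c) = c := by
  rw [evalZero_apply]
  exact constantCoeff_C c

theorem evalZero_smul (c : ℂ) (g : Germs n) : evalZero n (c • g) = c * evalZero n g := by
  rw [Algebra.smul_def, map_mul, evalZero_algebraMap]

theorem cf_single_mul (j : Fin (n + 1)) (g h : Germs n) :
    cf (Finsupp.single j 1) (g * h) =
      evalZero n g * cf (Finsupp.single j 1) h + evalZero n h * cf (Finsupp.single j 1) g := by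
  classical
  simp only [cf_apply, evalZero_apply, ← coeff_zero_eq_constantCoeff_apply]
  rw [show ((g * h : Germs n) : MvPowerSeries (Fin (n + 1)) ℂ) = g.1 * h.1 from rfl, coeff_mul,
    Finsupp.antidiagonal_single]
  simp [Finset.Nat.antidiagonal_succ]
  ring

theorem cf_coord_mul (i : Fin (n + 1)) (g : Germs n) (m : Fin (n + 1) →₀ ℕ) :
    cf m (coord i * g) = if m i = 0 then 0 else cf (m - Finsupp.single i 1) g := by
  classical
  rw [cf_apply, show ((coord i * g : Germs n) : MvPowerSeries (Fin (n + 1)) ℂ) = X i * g.1 from rfl,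
    X, coeff_monomial_mul]
  have : (Finsupp.single i 1 ≤ m) ↔ ¬ m i = 0 := by
    rw [Finsupp.single_le_iff]; omega
  simp only [this, one_mul, ite_not]
  rfl

theorem cf_partialDer (i : Fin (n + 1)) (g : Germs n) (m : Fin (n + 1) →₀ ℕ) :
    cf m (partialDer i g) = cf (m + Finsupp.single i 1) g * (m i + 1) :=
  coeff_pderiv _ _

theorem partialDer_coord (i j : Fin (n + 1)) :
    partialDer i (coord j : Germs n) = if j = i then 1 else 0 := by
  refine Subtype.ext ?_
  rw [show (partialDer i (coord j : Germs n) : Germs n).1 =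
    MvPowerSeries.pderiv ℂ i (X j : MvPowerSeries (Fin (n + 1)) ℂ) from rfl, pderiv_X]
  by_cases h : j = i
  · subst h; simp
  · simp [h]

theorem partialDer_comm (i j : Fin (n + 1)) (g : Germs n) :
    partialDer i (partialDer j g) = partialDer j (partialDer i g) := by
  classical
  refine germ_ext fun m => ?_
  simp only [cf_partialDer, Finsupp.add_apply]
  rw [add_right_comm]
  by_cases h : i = j
  · subst h; rfl
  · simp [h, Ne.symm h]
    ring

/-! ### Powers of the maximal ideal -/

/-- A germ of order at least `k + 1` is a combination of the coordinates with coefficients of order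
at least `k`. -/
theorem exists_eq_sum_coord_mul {k : ℕ} {g : Germs n}
    (hg : ∀ m : Fin (n + 1) →₀ ℕ, m.degree < k + 1 → cf m g = 0) :
    ∃ h : Fin (n + 1) → Germs n, (∀ i m, m.degree < k → cf m (h i) = 0) ∧
      g = ∑ i, coord i * h i := by
  classical
  have hex : ∀ m : Fin (n + 1) →₀ ℕ, ∃ i, m ≠ 0 → m i ≠ 0 := by
    intro m
    by_cases hm : m = 0
    · exact ⟨0, fun h => (h hm).elim⟩
    · obtain ⟨i, hi⟩ := Finsupp.ne_iff.1 hm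
      exact ⟨i, fun _ => by simpa using hi⟩
  -- `c` picks for each nonzero monomial a variable dividing it, and `H i` collects the quotients by
  -- `x_i` of the monomials assigned to `i`; the value of `c` at `0` plays no role.
  choose c hc using hex
  obtain ⟨H, hH⟩ : ∃ H : Fin (n + 1) → MvPowerSeries (Fin (n + 1)) ℂ,
      ∀ i m, coeff m (H i) =
        if c (m + Finsupp.single i 1) = i then cf (m + Finsupp.single i 1) g else 0 :=
    exists_coeff_eq fun i m =>
      if c (m + Finsupp.single i 1) = i then cf (m + Finsupp.single i 1) g else 0
  obtain ⟨r, hr, hfin⟩ := conv_coe g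
  have hHc : ∀ i, Conv (H i) := by
    intro i
    refine ⟨r, hr, ?_⟩
    have hle : nrm r (H i) * r ≤ nrm r (g : MvPowerSeries (Fin (n + 1)) ℂ) := by
      unfold nrm
      rw [← ENNReal.tsum_mul_right]
      refine le_trans ?_ (ENNReal.tsum_comp_le_tsum_of_injective
        (f := fun m : Fin (n + 1) →₀ ℕ => m + Finsupp.single i 1)
        (fun a b hab => add_right_cancel hab) _)
      refine ENNReal.tsum_le_tsum fun m => ?_
      rw [map_add, Finsupp.degree_single, pow_succ, ← mul_assoc]
      gcongr
      rw [hH]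
      split_ifs
      · rw [cf_apply]
      · simp
    intro htop
    rw [htop, ENNReal.top_mul (by exact_mod_cast hr.ne')] at hle
    exact hfin (top_le_iff.1 hle)
  refine ⟨fun i => ofConv (hHc i), fun i m hm => ?_, germ_ext fun m => ?_⟩
  · rw [cf_apply, coe_ofConv, hH]
    split_ifs
    · exact hg _ (by simpa using hm)
    · rfl
  · rw [map_sum]
    by_cases hm0 : m = 0
    · subst hm0
      simp [cf_coord_mul, hg 0 (by simp)]
    rw [Finset.sum_eq_single (c m)]
    · have h1 : Finsupp.single (c m) 1 ≤ m := by
        rw [Finsupp.single_le_iff]; exact Nat.one_le_iff_ne_zero.2 (hc m hm0)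
      rw [cf_coord_mul, if_neg (hc m hm0), cf_apply _ (ofConv _), coe_ofConv, hH,
        tsub_add_cancel_of_le h1, if_pos rfl]
    · intro i _ hi
      rw [cf_coord_mul]
      split_ifs with h
      · rfl
      · have h1 : Finsupp.single i 1 ≤ m := by
          rw [Finsupp.single_le_iff]; exact Nat.one_le_iff_ne_zero.2 h
        rw [cf_apply _ (ofConv _), coe_ofConv, hH, tsub_add_cancel_of_le h1, if_neg (Ne.symm hi)]
    · simp

theorem maxIdeal_eq_span : maxIdeal n = Ideal.span (Set.range (coord (n := n))) := by
  refine le_antisymm (fun g hg => ?_) (Ideal.span_le.2 ?_)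
  · obtain ⟨h, -, e⟩ := exists_eq_sum_coord_mul (k := 0) (g := g) (fun m hm => by
      have : m = 0 := (Finsupp.degree_eq_zero_iff m).1 (by omega)
      rw [this, cf_zero]; exact mem_maxIdeal.1 hg)
    rw [e]
    exact Ideal.sum_mem _ fun i _ => Ideal.mul_mem_right _ _ (Ideal.subset_span ⟨i, rfl⟩)
  · rintro _ ⟨i, rfl⟩
    exact coord_mem i

theorem maxIdeal_fg : (maxIdeal n).FG := by
  rw [maxIdeal_eq_span]
  exact ⟨(Set.finite_range (coord (n := n))).toFinset, by simp⟩

/-- Orders add under multiplication, and conversely coordinates split off one at a time by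
`exists_eq_sum_coord_mul`. This turns questions about `𝔪`-adic membership into questions about
coefficients. -/
theorem mem_maxIdeal_pow {k : ℕ} {g : Germs n} :
    g ∈ maxIdeal n ^ k ↔ ∀ m : Fin (n + 1) →₀ ℕ, m.degree < k → cf m g = 0 := by
  induction k generalizing g with
  | zero => simp
  | succ k ih =>
    constructor
    · intro hg
      have : ((k + 1 : ℕ) : ℕ∞) ≤ (g : MvPowerSeries (Fin (n + 1)) ℂ).order := by
        rw [pow_succ] at hg
        refine Submodule.mul_induction_on hg (fun a ha b hb => ?_) (fun a b ha hb => ?_)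
        · refine le_order_mul_of_le (le_order_iff.2 (ih.1 ha)) ?_
          exact_mod_cast one_le_order_iff_constCoeff_eq_zero.2 (mem_maxIdeal.1 hb)
        · exact le_order_add_of_le ha hb
      exact le_order_iff.1 this
    · intro hg
      obtain ⟨h, hh, e⟩ := exists_eq_sum_coord_mul hg
      rw [e, pow_succ']
      exact Ideal.sum_mem _ fun i _ => Ideal.mul_mem_mul (coord_mem i) (ih.2 (hh i))

theorem eq_zero_of_forall_mem_maxIdeal_pow {g : Germs n} (h : ∀ k, g ∈ maxIdeal n ^ k) : g = 0 :=
  germ_ext fun m => by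
    rw [mem_maxIdeal_pow.1 (h (m.degree + 1)) m (Nat.lt_succ_self _), map_zero]

theorem maxIdeal_pow_fg (k : ℕ) : (maxIdeal n ^ k).FG := maxIdeal_fg.pow

/-! ### Units and Nakayama's lemma -/

/-- The system `ψ₀ = v`, `ψ₁ = v + ψ₀ ψ₁` has a convergent solution by the fixed point theorem, and
`1 + ψ₁` inverts `1 - v`. The extra unknown `ψ₀` makes the nonlinear term `X 0 * X 1` have order
two. -/
theorem isUnit_one_sub {v : Germs n} (hv : v ∈ maxIdeal n) : IsUnit (1 - v) := by
  let ℓ : Fin 2 → MvPowerSeries (Fin (n + 1)) ℂ := fun _ => v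
  let u : Fin 2 → MvPowerSeries (Fin 2) ℂ := ![0, X 0 * X 1]
  have hX : ∀ i : Fin 2, Conv (X i : MvPowerSeries (Fin 2) ℂ) := fun i =>
    ⟨1, one_pos, by rw [nrm_X]; simp⟩
  obtain ⟨ψ, hψc, hψ0, hψ⟩ := exists_conv_fixedPoint (ℓ := ℓ) (u := u) (fun _ => conv_coe v)
    (fun _ => mem_maxIdeal.1 hv) (fun i => by
      fin_cases i
      · exact ⟨1, one_pos, by simp [u, nrm]⟩
      · refine ⟨1, one_pos, ne_top_of_le_ne_top ?_ (nrm_mul_le _ _ _)⟩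
        simp [nrm_X]) (fun i => by
      fin_cases i
      · simp [u]
      · exact le_order_mul_of_le (a := 1) (b := 1)
          (by exact_mod_cast one_le_order_iff_constCoeff_eq_zero.2 (constantCoeff_X (0 : Fin 2)))
          (by exact_mod_cast one_le_order_iff_constCoeff_eq_zero.2 (constantCoeff_X (1 : Fin 2))))
  have hs : HasSubst ψ := hasSubst_of_constantCoeff_zero hψ0
  have h0 : ψ 0 = v := by
    rw [hψ 0]
    simp only [ℓ, u, Matrix.cons_val_zero]
    rw [← coe_substAlgHom hs, map_zero, add_zero]
  have h1 : ψ 1 = v + v * ψ 1 := by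
    conv_lhs => rw [hψ 1]
    simp only [ℓ, u, Matrix.cons_val_one, Matrix.cons_val_zero]
    rw [subst_mul hs, subst_X hs, subst_X hs, h0]
  refine IsUnit.of_mul_eq_one (1 + ofConv (hψc 1)) (Subtype.ext ?_)
  change (1 - v.1) * (1 + ψ 1) = 1
  linear_combination h1

theorem isUnit_iff {g : Germs n} : IsUnit g ↔ evalZero n g ≠ 0 := by
  constructor
  · exact fun h => (h.map (evalZero n)).ne_zero
  · intro h
    set c := evalZero n g with hc
    have h1 : IsUnit (1 - (1 - algebraMap ℂ (Germs n) c⁻¹ * g)) :=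
      isUnit_one_sub (mem_maxIdeal.2 (by simp [← hc, h]))
    rw [sub_sub_cancel] at h1
    exact isUnit_of_mul_isUnit_right h1

theorem mem_maxIdeal_iff_not_isUnit {g : Germs n} : g ∈ maxIdeal n ↔ ¬ IsUnit g := by
  rw [isUnit_iff, mem_maxIdeal, not_not]

theorem maxIdeal_le_jacobson : maxIdeal n ≤ Ideal.jacobson ⊥ := by
  intro g hg
  rw [Ideal.mem_jacobson_bot]
  intro y
  have := isUnit_one_sub (v := -(g * y)) (neg_mem (Ideal.mul_mem_right _ _ hg))
  rwa [sub_neg_eq_add, add_comm (1 : Germs n)] at this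

/-- Nakayama's lemma for powers of the maximal ideal. -/
theorem maxIdeal_pow_le_of_le_sup {N k : ℕ} (hk : N < k) {I : Ideal (Germs n)}
    (h : maxIdeal n ^ N ≤ I ⊔ maxIdeal n ^ k) : maxIdeal n ^ N ≤ I := by
  refine Submodule.le_of_le_smul_of_le_jacobson_bot (maxIdeal_pow_fg N) maxIdeal_le_jacobson ?_
  refine h.trans (sup_le_sup_left ?_ _)
  rw [smul_eq_mul, ← pow_succ']
  exact Ideal.pow_le_pow_right hk

theorem not_maxIdeal_pow_le {N k : ℕ} (hk : N < k) : ¬ maxIdeal n ^ N ≤ maxIdeal n ^ k := by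
  intro h
  have h1 : coord (0 : Fin (n + 1)) ^ N ∈ maxIdeal n ^ k := h (Ideal.pow_mem_pow (coord_mem 0) N)
  have h2 := mem_maxIdeal_pow.1 h1 (Finsupp.single 0 N) (by simpa using hk)
  rw [cf_apply, show ((coord (0 : Fin (n + 1)) ^ N : Germs n) : MvPowerSeries (Fin (n + 1)) ℂ) =
    X 0 ^ N from rfl, X_pow_eq, coeff_monomial_same] at h2
  exact one_ne_zero h2

/-! ### Polynomials and truncation -/

/-- A polynomial as a germ. -/
def ofPoly (n : ℕ) : MvPolynomial (Fin (n + 1)) ℂ →ₐ[ℂ] Germs n := MvPolynomial.aeval coord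

theorem coe_ofPoly (p : MvPolynomial (Fin (n + 1)) ℂ) :
    (ofPoly n p : MvPowerSeries (Fin (n + 1)) ℂ) = p := by
  induction p using MvPolynomial.induction_on with
  | C a =>
    rw [ofPoly, MvPolynomial.aeval_C, MvPolynomial.coe_C]
    rfl
  | add p q hp hq =>
    rw [map_add, MvPolynomial.coe_add, ← hp, ← hq]
    rfl
  | mul_X p i hp =>
    rw [map_mul, MvPolynomial.coe_mul, ← hp, ofPoly, MvPolynomial.aeval_X, MvPolynomial.coe_X]
    rfl

theorem cf_ofPoly (m : Fin (n + 1) →₀ ℕ) (p : MvPolynomial (Fin (n + 1)) ℂ) :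
    cf m (ofPoly n p) = p.coeff m := by
  rw [cf_apply, coe_ofPoly, MvPolynomial.coeff_coe]

/-- The Taylor polynomial of a germ of degree less than `k`. -/
def jet (k : ℕ) (g : Germs n) : MvPolynomial (Fin (n + 1)) ℂ :=
  truncTotal k (g : MvPowerSeries (Fin (n + 1)) ℂ)

theorem coeff_jet (k : ℕ) (g : Germs n) (m : Fin (n + 1) →₀ ℕ) :
    (jet k g).coeff m = if m.degree < k then cf m g else 0 := by
  classical
  rw [jet, coeff_truncTotal_eq_ite]
  rfl

theorem sub_ofPoly_jet_mem (k : ℕ) (g : Germs n) : g - ofPoly n (jet k g) ∈ maxIdeal n ^ k := by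
  rw [mem_maxIdeal_pow]
  intro m hm
  rw [map_sub, cf_ofPoly, coeff_jet, if_pos hm, sub_self]

/-! ### Derivations -/

theorem derivation_mem_pow (δ : VectorFields n) {k : ℕ} {g : Germs n}
    (hg : g ∈ maxIdeal n ^ (k + 1)) : δ g ∈ maxIdeal n ^ k := by
  induction k generalizing g with
  | zero => simp
  | succ k ih =>
    rw [pow_succ] at hg
    refine Submodule.mul_induction_on hg (fun a ha b hb => ?_) (fun a b ha hb => ?_)
    · rw [δ.leibniz, smul_eq_mul, smul_eq_mul]
      refine add_mem (Ideal.mul_mem_right _ _ ha) ?_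
      rw [pow_succ']
      exact Ideal.mul_mem_mul hb (ih ha)
    · rw [map_add]; exact add_mem ha hb

theorem derivation_ofPoly_eq_zero {δ : VectorFields n} (h : ∀ i, δ (coord i) = 0)
    (p : MvPolynomial (Fin (n + 1)) ℂ) : δ (ofPoly n p) = 0 := by
  induction p using MvPolynomial.induction_on with
  | C a => rw [ofPoly, MvPolynomial.aeval_C, δ.map_algebraMap]
  | add p q hp hq => rw [map_add, map_add, hp, hq, add_zero]
  | mul_X p i hp =>
    rw [map_mul, δ.leibniz, hp, ofPoly, MvPolynomial.aeval_X, h i]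
    simp

/-- A derivation lowers the `𝔪`-adic order by at most one, so it is continuous and determined on
polynomials. -/
theorem derivation_ext {δ ε : VectorFields n} (h : ∀ i, δ (coord i) = ε (coord i)) : δ = ε := by
  rw [← sub_eq_zero]
  ext1 g
  refine eq_zero_of_forall_mem_maxIdeal_pow fun k => ?_
  have h1 := derivation_mem_pow (δ - ε) (sub_ofPoly_jet_mem (k + 1) g)
  rwa [map_sub, derivation_ofPoly_eq_zero (fun i => by simp [h i]), sub_zero] at h1

theorem derivation_sum_apply {ι : Type*} (s : Finset ι) (D : ι → VectorFields n) (g : Germs n) :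
    (∑ i ∈ s, D i) g = ∑ i ∈ s, D i g := by
  classical
  induction s using Finset.induction_on with
  | empty => simp
  | insert a s ha ih => rw [Finset.sum_insert ha, Finset.sum_insert ha, Derivation.add_apply, ih]

theorem derivation_eq_sum (δ : VectorFields n) : δ = ∑ i, δ (coord i) • partialDer i := by
  refine derivation_ext fun j => ?_
  rw [derivation_sum_apply]
  simp [partialDer_coord]

theorem derivation_apply (δ : VectorFields n) (g : Germs n) :
    δ g = ∑ i, δ (coord i) * partialDer i g := by
  conv_lhs => rw [derivation_eq_sum δ]
  rw [derivation_sum_apply]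
  rfl

theorem mem_vanishingDer {δ : VectorFields n} (h : ∀ i, δ (coord i) ∈ maxIdeal n) :
    δ ∈ vanishingDer n := by
  rw [derivation_eq_sum δ]
  exact Submodule.sum_mem _ fun i _ => Submodule.smul_mem_smul (h i) trivial

/-- A vector field vanishing at the origin preserves the `𝔪`-adic filtration. -/
theorem derivation_mem_pow_of_coord {δ : VectorFields n} (h : ∀ i, δ (coord i) ∈ maxIdeal n)
    {k : ℕ} {g : Germs n} (hg : g ∈ maxIdeal n ^ k) : δ g ∈ maxIdeal n ^ k := by
  cases k with
  | zero => simp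
  | succ k =>
    rw [derivation_apply]
    refine Ideal.sum_mem _ fun i _ => ?_
    rw [pow_succ']
    exact Ideal.mul_mem_mul (h i) (derivation_mem_pow _ hg)

end

section

variable {n : ℕ}

/-! ### Endomorphisms and automorphisms -/

/-- If `φ g` had value `c ≠ 0` at the origin, `g - c` would be a unit whose image vanishes there.
Hence every `ℂ`-algebra endomorphism is local and `𝔪`-adically continuous. -/
theorem algHom_mem_maxIdeal (φ : Germs n →ₐ[ℂ] Germs n) {g : Germs n} (hg : g ∈ maxIdeal n) :
    φ g ∈ maxIdeal n := by
  rw [mem_maxIdeal]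
  by_contra hc
  set c := evalZero n (φ g) with hcdef
  have h1 : IsUnit (g - algebraMap ℂ (Germs n) c) := by
    rw [isUnit_iff, map_sub, mem_maxIdeal.1 hg, evalZero_algebraMap]
    simpa using hc
  have h2 := isUnit_iff.1 (h1.map φ)
  rw [map_sub, AlgHom.commutes, map_sub, evalZero_algebraMap, ← hcdef, sub_self] at h2
  exact h2 rfl

theorem algHom_mem_maxIdeal_pow (φ : Germs n →ₐ[ℂ] Germs n) {k : ℕ} {g : Germs n}
    (hg : g ∈ maxIdeal n ^ k) : φ g ∈ maxIdeal n ^ k := by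
  have h : (maxIdeal n ^ k).map (φ : Germs n →+* Germs n) ≤ maxIdeal n ^ k := by
    rw [Ideal.map_pow]
    refine Ideal.pow_right_mono (Ideal.map_le_iff_le_comap.2 ?_) k
    exact fun x hx => algHom_mem_maxIdeal φ hx
  exact h (Ideal.mem_map_of_mem (φ : Germs n →+* Germs n) hg)

theorem algHom_ext {φ ψ : Germs n →ₐ[ℂ] Germs n} (h : ∀ i, φ (coord i) = ψ (coord i)) : φ = ψ := by
  have hp : φ.comp (ofPoly n) = ψ.comp (ofPoly n) :=
    MvPolynomial.algHom_ext fun i => by simpa [ofPoly] using h i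
  ext1 g
  rw [← sub_eq_zero]
  refine eq_zero_of_forall_mem_maxIdeal_pow fun k => ?_
  have h1 := sub_ofPoly_jet_mem k g
  have h2 := sub_mem (algHom_mem_maxIdeal_pow φ h1) (algHom_mem_maxIdeal_pow ψ h1)
  have h3 : φ (ofPoly n (jet k g)) = ψ (ofPoly n (jet k g)) := DFunLike.congr_fun hp (jet k g)
  rwa [map_sub, map_sub, h3, sub_sub_sub_cancel_right] at h2

/-- Substitution of germs vanishing at the origin for the coordinates. -/
def substHom (y : Fin (n + 1) → Germs n) (hy : ∀ i, y i ∈ maxIdeal n) : Germs n →ₐ[ℂ] Germs n :=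
  ((substAlgHom (R := ℂ) (a := fun i => (y i : MvPowerSeries (Fin (n + 1)) ℂ))
    (hasSubst_of_constantCoeff_zero fun i => mem_maxIdeal.1 (hy i))).comp
      (convergent n).val).codRestrict (convergent n) fun g => by
        rw [AlgHom.comp_apply, coe_substAlgHom]
        exact (isConvergent_iff_conv _).2
          (Conv.subst (fun i => conv_coe (y i)) (fun i => mem_maxIdeal.1 (hy i)) (conv_coe g))

theorem coe_substHom (y : Fin (n + 1) → Germs n) (hy : ∀ i, y i ∈ maxIdeal n) (g : Germs n) :
    (substHom y hy g : MvPowerSeries (Fin (n + 1)) ℂ) =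
      subst (fun i => (y i : MvPowerSeries (Fin (n + 1)) ℂ))
        (g : MvPowerSeries (Fin (n + 1)) ℂ) := by
  rw [← coe_substAlgHom (hasSubst_of_constantCoeff_zero fun i => mem_maxIdeal.1 (hy i))]
  rfl

@[simp] theorem substHom_coord (y : Fin (n + 1) → Germs n) (hy : ∀ i, y i ∈ maxIdeal n)
    (i : Fin (n + 1)) : substHom y hy (coord i) = y i := by
  refine Subtype.ext ?_
  rw [coe_substHom, coe_coord, subst_X (hasSubst_of_constantCoeff_zero fun i =>
    mem_maxIdeal.1 (hy i))]

/-- The matrix of linear parts of a tuple of germs. -/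
def jac {ι : Type*} (y : ι → Germs n) : Matrix ι (Fin (n + 1)) ℂ :=
  Matrix.of fun i j => cf (Finsupp.single j 1) (y i)

theorem cf_single_coord (i j : Fin (n + 1)) :
    cf (Finsupp.single j 1) (coord i : Germs n) = if j = i then 1 else 0 := by
  classical
  rw [cf_apply, coe_coord, coeff_index_single_X]

theorem cf_single_of_mem_sq {g : Germs n} (hg : g ∈ maxIdeal n ^ 2) (j : Fin (n + 1)) :
    cf (Finsupp.single j 1) g = 0 := mem_maxIdeal_pow.1 hg _ (by simp)

theorem exists_eq_single_of_degree_eq_one {m : Fin (n + 1) →₀ ℕ} (h : m.degree = 1) :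
    ∃ i, m = Finsupp.single i 1 := by
  have h0 : m ≠ 0 := by rintro rfl; simp at h
  obtain ⟨i, hi⟩ := Finsupp.ne_iff.1 h0
  have h1 : Finsupp.single i 1 ≤ m := by
    rw [Finsupp.single_le_iff]; exact Nat.one_le_iff_ne_zero.2 hi
  have h2 := congrArg Finsupp.degree (tsub_add_cancel_of_le h1)
  rw [map_add, Finsupp.degree_single, h] at h2
  have h3 := (Finsupp.degree_eq_zero_iff (m - Finsupp.single i 1)).1 (by omega)
  exact ⟨i, by rw [← tsub_add_cancel_of_le h1, h3, zero_add]⟩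

theorem mem_sq_of_cf {g : Germs n} (hg : g ∈ maxIdeal n)
    (h : ∀ j, cf (Finsupp.single j 1) g = 0) : g ∈ maxIdeal n ^ 2 := by
  rw [mem_maxIdeal_pow]
  intro m hm
  by_cases h0 : m.degree = 0
  · rw [(Finsupp.degree_eq_zero_iff m).1 h0, cf_zero]
    exact mem_maxIdeal.1 hg
  · obtain ⟨i, rfl⟩ := exists_eq_single_of_degree_eq_one (m := m) (by omega)
    exact h i

theorem sub_linear_mem_sq {g : Germs n} (hg : g ∈ maxIdeal n) :
    g - ∑ j, cf (Finsupp.single j 1) g • coord j ∈ maxIdeal n ^ 2 := by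
  refine mem_sq_of_cf (sub_mem hg (sum_mem fun j _ => ?_)) fun j => ?_
  · rw [Algebra.smul_def]
    exact Ideal.mul_mem_left _ _ (coord_mem j)
  · simp [cf_single_coord]

/-- With `y = P x + q`, `q ∈ 𝔪 ^ 2` and `Q = P⁻¹`, the inverse coordinates solve the fixed point
equation `ψ = Q x - Q q(ψ)`. The linear part `Q` is again invertible, so the lemma can be applied to
its own output. -/
theorem exists_leftInverse_substHom (y : Fin (n + 1) → Germs n) (hy : ∀ i, y i ∈ maxIdeal n)
    (hdet : IsUnit (jac y)) :
    ∃ (y' : Fin (n + 1) → Germs n) (hy' : ∀ i, y' i ∈ maxIdeal n), IsUnit (jac y') ∧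
      (substHom y' hy').comp (substHom y hy) = AlgHom.id ℂ (Germs n) := by
  obtain ⟨⟨P, Q, hPQ, hQP⟩, hP : P = jac y⟩ := hdet
  set q : Fin (n + 1) → Germs n := fun i => y i - ∑ j, P i j • coord j with hq
  have hq2 : ∀ i, q i ∈ maxIdeal n ^ 2 := fun i => by
    rw [hq, hP]; exact sub_linear_mem_sq (hy i)
  set u : Fin (n + 1) → Germs n := fun i => -∑ j, Q i j • q j with hu
  have hu2 : ∀ i, u i ∈ maxIdeal n ^ 2 := fun i =>
    neg_mem (sum_mem fun j _ => by
      rw [Algebra.smul_def]; exact Ideal.mul_mem_left _ _ (hq2 j))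
  set ℓ : Fin (n + 1) → Germs n := fun i => ∑ j, Q i j • coord j with hℓ
  have hℓm : ∀ i, ℓ i ∈ maxIdeal n := fun i => sum_mem fun j _ => by
      rw [Algebra.smul_def]; exact Ideal.mul_mem_left _ _ (coord_mem j)
  have hmul : ∀ (A B : Matrix (Fin (n + 1)) (Fin (n + 1)) ℂ) (v : Fin (n + 1) → Germs n) i,
      ∑ j, A i j • ∑ k, B j k • v k = ∑ k, (A * B) i k • v k := by
    intro A B v i
    simp_rw [Finset.smul_sum, Matrix.mul_apply, Finset.sum_smul, mul_smul]
    exact Finset.sum_comm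
  have hone : ∀ (v : Fin (n + 1) → Germs n) i,
      ∑ k, (1 : Matrix (Fin (n + 1)) (Fin (n + 1)) ℂ) i k • v k = v i := by
    intro v i
    simp [Matrix.one_apply]
  obtain ⟨ψ, hψc, hψ0, hψ⟩ := exists_conv_fixedPoint
    (ℓ := fun i => (ℓ i : MvPowerSeries (Fin (n + 1)) ℂ))
    (u := fun i => (u i : MvPowerSeries (Fin (n + 1)) ℂ)) (fun i => conv_coe _)
    (fun i => mem_maxIdeal.1 (hℓm i)) (fun i => conv_coe _)
    (fun i => le_order_iff.2 (mem_maxIdeal_pow.1 (hu2 i)))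
  have hy' : ∀ i, ofConv (hψc i) ∈ maxIdeal n := fun i => mem_maxIdeal.2 (hψ0 i)
  set Ψ := substHom (fun i => ofConv (hψc i)) hy' with hΨ
  have hΨu : ∀ i, ofConv (hψc i) = ℓ i + Ψ (u i) := by
    intro i
    refine Subtype.ext ?_
    rw [coe_ofConv, hψ i, hΨ]
    change _ = (ℓ i).1 + (substHom (fun i => ofConv (hψc i)) hy' (u i)).1
    rw [coe_substHom]
    rfl
  refine ⟨fun i => ofConv (hψc i), hy', ?_, algHom_ext fun i => ?_⟩
  · have : jac (fun i => ofConv (hψc i)) = Q := by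
      ext i j
      rw [jac, Matrix.of_apply, hΨu, map_add,
        cf_single_of_mem_sq (algHom_mem_maxIdeal_pow Ψ (hu2 i)), add_zero, hℓ]
      simp [cf_single_coord]
    rw [this]
    exact ⟨⟨Q, P, hQP, hPQ⟩, rfl⟩
  · rw [AlgHom.comp_apply, substHom_coord, AlgHom.id_apply, ← hΨ]
    have hqu : q i = -∑ j, P i j • u j := by
      simp only [hu, smul_neg, Finset.sum_neg_distrib, neg_neg]
      rw [hmul, hPQ, hone]
    have hyi : y i = ∑ j, P i j • (coord j - u j) := by
      simp only [smul_sub, Finset.sum_sub_distrib]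
      rw [sub_eq_add_neg, ← hqu, hq]
      ring
    have hΨj : ∀ j, Ψ (coord j - u j) = ℓ j := by
      intro j
      rw [map_sub, hΨ, substHom_coord, ← hΨ, hΨu, add_sub_cancel_right]
    rw [hyi, map_sum]
    simp_rw [map_smul, hΨj, hℓ]
    rw [hmul, hPQ, hone]

/-- The inverse function theorem: a tuple of germs with invertible linear part is the image of the
coordinates under an automorphism. -/
theorem exists_algEquiv (y : Fin (n + 1) → Germs n) (hy : ∀ i, y i ∈ maxIdeal n)
    (hdet : IsUnit (jac y)) : ∃ φ : Germs n ≃ₐ[ℂ] Germs n, ∀ i, φ (coord i) = y i := by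
  obtain ⟨y', hy', hdet', h1⟩ := exists_leftInverse_substHom y hy hdet
  obtain ⟨y'', hy'', -, h2⟩ := exists_leftInverse_substHom y' hy' hdet'
  -- A left inverse that itself has a left inverse is two-sided.
  have h3 : substHom y'' hy'' = substHom y hy := by
    calc substHom y'' hy'' = (substHom y'' hy'').comp
          ((substHom y' hy').comp (substHom y hy)) := by rw [h1, AlgHom.comp_id]
      _ = _ := by rw [← AlgHom.comp_assoc, h2, AlgHom.id_comp]
  rw [h3] at h2
  exact ⟨AlgEquiv.ofAlgHom (substHom y hy) (substHom y' hy') h2 h1, fun i => substHom_coord y hy i⟩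

/-! ### The number of generators of an `𝔪`-primary ideal -/

/-- Modulo the ideal of the `g i`, every germ is a polynomial of degree below `N`; expanding the
coefficients again and again gives a `g`-adic expansion. -/
theorem exists_sub_mem_pow_of_pow_le {ι : Type*} [Fintype ι] (g : ι → Germs n)
    (hg : ∀ i, g i ∈ maxIdeal n) {N : ℕ} (h : maxIdeal n ^ N ≤ Ideal.span (Set.range g)) (s : ℕ)
    (f : Germs n) :
    ∃ w ∈ Submodule.span ℂ {w : Germs n | ∃ (α : Fin (n + 1) →₀ ℕ) (β : ι → ℕ), α.degree < N ∧
      (∀ i, β i < s) ∧ w = ofPoly n (MvPolynomial.monomial α 1) * ∏ i, g i ^ β i},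
      f - w ∈ maxIdeal n ^ s := by
  classical
  -- The induction runs with the bound on the total exponent `∑ β i`; the bound on each `β i` is
  -- what the dimension count needs.
  suffices H : ∃ w ∈ Submodule.span ℂ {w : Germs n | ∃ (α : Fin (n + 1) →₀ ℕ) (β : ι → ℕ),
      α.degree < N ∧ (∑ i, β i < s) ∧
        w = ofPoly n (MvPolynomial.monomial α 1) * ∏ i, g i ^ β i},
      f - w ∈ maxIdeal n ^ s by
    obtain ⟨w, hw, hw'⟩ := H
    refine ⟨w, Submodule.span_mono ?_ hw, hw'⟩
    rintro _ ⟨α, β, hα, hβ, rfl⟩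
    exact ⟨α, β, hα, fun i =>
      (Finset.single_le_sum (fun _ _ => Nat.zero_le _) (Finset.mem_univ i)).trans_lt hβ, rfl⟩
  induction s generalizing f with
  | zero => exact ⟨0, zero_mem _, by simp⟩
  | succ s ih =>
    obtain ⟨c, hc⟩ := (Submodule.mem_span_range_iff_exists_fun _).1 (h (sub_ofPoly_jet_mem N f))
    choose w hw hw' using fun i => ih (c i)
    refine ⟨ofPoly n (jet N f) + ∑ i, g i * w i, add_mem ?_ (sum_mem fun i _ => ?_), ?_⟩
    · rw [(jet N f).as_sum, map_sum]
      refine sum_mem fun α hα => ?_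
      rw [← mul_one ((jet N f).coeff α), ← smul_eq_mul, ← MvPolynomial.smul_monomial, map_smul]
      refine Submodule.smul_mem _ _ (Submodule.subset_span ⟨α, 0, ?_, by simp, by simp⟩)
      by_contra hcon
      rw [MvPolynomial.mem_support_iff, coeff_jet, if_neg hcon] at hα
      exact hα rfl
    · have := Submodule.mem_map_of_mem (f := LinearMap.mulLeft ℂ (g i)) (hw i)
      rw [Submodule.map_span] at this
      refine Submodule.span_mono ?_ this
      rintro _ ⟨_, ⟨α, β, hα, hβ, rfl⟩, rfl⟩
      refine ⟨α, β + Pi.single i 1, hα, ?_, ?_⟩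
      · simp only [Pi.add_apply, Finset.sum_add_distrib, Finset.sum_pi_single', Finset.mem_univ,
          if_true]
        omega
      · simp only [LinearMap.mulLeft_apply, Pi.add_apply, pow_add, Finset.prod_mul_distrib]
        have : ∏ j, g j ^ (Pi.single i 1 : ι → ℕ) j = g i := by
          rw [Finset.prod_eq_single i] <;> simp +contextual
        rw [this]
        ring
    · have e : f - (ofPoly n (jet N f) + ∑ i, g i * w i) = ∑ i, g i * (c i - w i) := by
        simp only [mul_sub, Finset.sum_sub_distrib]
        rw [sub_add_eq_sub_sub, ← hc]
        simp [mul_comm]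
      rw [e, pow_succ']
      exact sum_mem fun i _ => Ideal.mul_mem_mul (hg i) (hw' i)

/-- An ideal between a power of `𝔪` and `𝔪` needs at least `n + 1` generators. -/
theorem le_card_of_pow_le_span {ι : Type*} [Fintype ι] (g : ι → Germs n)
    (hg : ∀ i, g i ∈ maxIdeal n) {N : ℕ} (h : maxIdeal n ^ N ≤ Ideal.span (Set.range g)) :
    n + 1 ≤ Fintype.card ι := by
  classical
  by_contra hlt
  have hfin : {α : Fin (n + 1) →₀ ℕ | α.degree < N}.Finite := by
    refine (Finsupp.finite_of_degree_le (N)).subset fun α hα => ?_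
    exact (show α.degree < N from hα).le
  have := hfin.fintype
  set A := Fintype.card {α : Fin (n + 1) →₀ ℕ | α.degree < N} with hA
  set q := Fintype.card ι with hq
  -- The `t ^ (n + 1)` monomials with exponents below `t` survive modulo `𝔪 ^ s`, `s = (n + 1) t`,
  -- while that quotient is spanned by `A * s ^ q` products. For `q ≤ n` this fails for large `t`.
  have key : ∀ t : ℕ, 0 < t → t ^ (n + 1) ≤ A * ((n + 1) * t) ^ q := by
    intro t ht
    set s := (n + 1) * t with hs
    let e : (Fin (n + 1) → Fin t) → (Fin (n + 1) →₀ ℕ) := fun a =>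
      Finsupp.equivFunOnFinite.symm fun i => (a i : ℕ)
    have he : ∀ a, (e a).degree < s := by
      intro a
      rw [Finsupp.degree_eq_sum]
      calc ∑ i, e a i < ∑ i : Fin (n + 1), t :=
            Finset.sum_lt_sum_of_nonempty Finset.univ_nonempty fun i _ => (a i).2
        _ = s := by simp [hs]
    have hinj : Function.Injective e := by
      intro a b hab
      ext i
      exact DFunLike.congr_fun hab i
    let c : Germs n →ₗ[ℂ] ((Fin (n + 1) → Fin t) → ℂ) := LinearMap.pi fun a => cf (e a)
    let v : {α : Fin (n + 1) →₀ ℕ | α.degree < N} × (ι → Fin s) →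
        ((Fin (n + 1) → Fin t) → ℂ) := fun p =>
      c (ofPoly n (MvPolynomial.monomial p.1.1 1) * ∏ i, g i ^ (p.2 i : ℕ))
    have hspan : Submodule.span ℂ (Set.range v) = ⊤ := by
      rw [eq_top_iff]
      rintro x -
      obtain ⟨f, rfl⟩ : ∃ f, c f = x := by
        refine ⟨ofPoly n (∑ b, MvPolynomial.monomial (e b) (x b)), funext fun a => ?_⟩
        change cf (e a) _ = x a
        rw [cf_ofPoly, MvPolynomial.coeff_sum]
        simp only [MvPolynomial.coeff_monomial, hinj.eq_iff]
        simp
      obtain ⟨w, hw, hw'⟩ := exists_sub_mem_pow_of_pow_le g hg h s f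
      have hcf : c f = c w := by
        rw [← sub_eq_zero, ← map_sub]
        funext a
        exact mem_maxIdeal_pow.1 hw' _ (he a)
      rw [hcf]
      have := Submodule.mem_map_of_mem (f := c) hw
      rw [Submodule.map_span] at this
      refine Submodule.span_mono ?_ this
      rintro _ ⟨_, ⟨α, β, hα, hβ, rfl⟩, rfl⟩
      exact ⟨(⟨α, hα⟩, fun i => ⟨β i, hβ i⟩), rfl⟩
    have h1 := finrank_range_le_card (R := ℂ) v
    rw [Set.finrank, hspan, finrank_top] at h1
    simpa [hA, hq] using h1
  set t := A * (n + 1) ^ q + 1 with ht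
  have h1 := key t (Nat.succ_pos _)
  rw [mul_pow, ← mul_assoc] at h1
  have h2 : t ^ (q + 1) ≤ t ^ (n + 1) := Nat.pow_le_pow_right (Nat.succ_pos _) (by omega)
  rw [pow_succ'] at h2
  have h3 : t ≤ A * (n + 1) ^ q :=
    Nat.le_of_mul_le_mul_right (h2.trans h1) (pow_pos (Nat.succ_pos _) q)
  omega

/-! ### The Tjurina ideal -/

/-- The ideal generated by `f` and its partial derivatives. -/
def tjurina (f : Germs n) : Ideal (Germs n) :=
  Ideal.span ({f} ∪ Set.range fun i => partialDer i f)

theorem self_mem_tjurina (f : Germs n) : f ∈ tjurina f := Ideal.subset_span (Or.inl rfl)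

theorem partialDer_mem_tjurina (f : Germs n) (i : Fin (n + 1)) : partialDer i f ∈ tjurina f :=
  Ideal.subset_span (Or.inr ⟨i, rfl⟩)

theorem derivation_mem_tjurina (δ : VectorFields n) (f : Germs n) : δ f ∈ tjurina f := by
  rw [derivation_apply]
  exact sum_mem fun i _ => Ideal.mul_mem_left _ _ (partialDer_mem_tjurina f i)

theorem tjurina_le {f : Germs n} {I : Ideal (Germs n)} :
    tjurina f ≤ I ↔ f ∈ I ∧ ∀ i, partialDer i f ∈ I := by
  rw [tjurina, Ideal.span_le, Set.union_subset_iff, Set.singleton_subset_iff,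
    Set.range_subset_iff]
  rfl

/-- The radical of the Tjurina ideal is the vanishing ideal of its zero locus, here `𝔪`, which is
finitely generated. -/
theorem IsIsolatedSingularity.exists_pow_le {f : Germs n} (h : IsIsolatedSingularity f) :
    ∃ N, maxIdeal n ^ N ≤ tjurina f := by
  have h1 : (tjurina f).radical = maxIdeal n := by
    rw [← PrimeSpectrum.vanishingIdeal_zeroLocus_eq_radical, tjurina,
      PrimeSpectrum.zeroLocus_span]
    have := h.singularLocus_eq
    rw [singularLocus] at this
    rw [this, PrimeSpectrum.vanishingIdeal_singleton]
    rfl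
  exact Ideal.exists_pow_le_of_le_radical_of_fg h1.ge maxIdeal_fg

/-- The derivation `φ ∘ δ ∘ φ⁻¹`. -/
def conjDer (φ : Germs n ≃ₐ[ℂ] Germs n) (δ : VectorFields n) : VectorFields n :=
  Derivation.mk' ((φ.toLinearMap.comp δ.toLinearMap).comp φ.symm.toLinearMap) fun a b => by
    simp [Derivation.leibniz]

theorem conjDer_apply (φ : Germs n ≃ₐ[ℂ] Germs n) (δ : VectorFields n) (g : Germs n) :
    conjDer φ δ g = φ (δ (φ.symm g)) := rfl

/-- Conjugating `∂_i` by `φ` gives a derivation, and every derivation sends `φ f` into its Tjurina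
ideal. -/
theorem pow_le_tjurina_map {f : Germs n} {N : ℕ} (h : maxIdeal n ^ N ≤ tjurina f)
    (φ : Germs n ≃ₐ[ℂ] Germs n) : maxIdeal n ^ N ≤ tjurina (φ f) := by
  intro g hg
  have h1 : tjurina f ≤ (tjurina (φ f)).comap (φ : Germs n →ₐ[ℂ] Germs n) := by
    rw [tjurina_le]
    refine ⟨self_mem_tjurina _, fun i => ?_⟩
    have := derivation_mem_tjurina (conjDer φ (partialDer i)) (φ f)
    rwa [conjDer_apply, AlgEquiv.symm_apply_apply] at this
  have h2 := h1 (h (algHom_mem_maxIdeal_pow (φ.symm : Germs n →ₐ[ℂ] Germs n) hg))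
  simpa using h2

theorem pow_le_tjurina_mul {f : Germs n} {N : ℕ} (h : maxIdeal n ^ N ≤ tjurina f)
    (u : (Germs n)ˣ) : maxIdeal n ^ N ≤ tjurina ((u : Germs n) * f) := by
  refine h.trans ?_
  have hf : f ∈ tjurina ((u : Germs n) * f) := by
    have := Ideal.mul_mem_left _ ((u⁻¹ : (Germs n)ˣ) : Germs n)
      (self_mem_tjurina ((u : Germs n) * f))
    rwa [Units.inv_mul_cancel_left] at this
  rw [tjurina_le]
  refine ⟨hf, fun i => ?_⟩
  have h1 : ((u⁻¹ : (Germs n)ˣ) : Germs n) *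
      (partialDer i ((u : Germs n) * f) - partialDer i (u : Germs n) * f) ∈
        tjurina ((u : Germs n) * f) :=
    Ideal.mul_mem_left _ _ (sub_mem (partialDer_mem_tjurina _ i) (Ideal.mul_mem_left _ _ hf))
  rw [Derivation.leibniz, smul_eq_mul, smul_eq_mul] at h1
  have h2 : (u : Germs n) * partialDer i f + f * partialDer i (u : Germs n) -
      partialDer i (u : Germs n) * f = u * partialDer i f := by ring
  rwa [h2, Units.inv_mul_cancel_left] at h1

theorem tjurina_le_maxIdeal {f : Germs n} (hf : f ∈ maxIdeal n ^ 2) :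
    tjurina f ≤ maxIdeal n := by
  rw [tjurina_le]
  refine ⟨Ideal.pow_le_self two_ne_zero hf, fun i => ?_⟩
  have := derivation_mem_pow (partialDer i) (k := 1) hf
  rwa [pow_one] at this

/-- On generators: `δ (∂_i f) = [δ, ∂_i] f + ∂_i (a f)`, and both terms lie in the ideal. -/
theorem derivation_tjurina_stable {f : Germs n} {δ : VectorFields n} (hδ : δ ∈ logDer f)
    {g : Germs n} (hg : g ∈ tjurina f) : δ g ∈ tjurina f := by
  have hspan : Ideal.span {f} ≤ tjurina f :=
    Ideal.span_le.2 (Set.singleton_subset_iff.2 (self_mem_tjurina f))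
  refine Submodule.span_induction (fun x hx => ?_) (by simp) (fun x y _ _ hx hy => ?_)
    (fun a x hxs hx => ?_) hg
  · rcases hx with rfl | ⟨i, rfl⟩
    · exact hspan hδ
    · obtain ⟨a, ha⟩ := Ideal.mem_span_singleton'.1 (show δ f ∈ Ideal.span {f} from hδ)
      have e : δ (partialDer i f) = ⁅δ, partialDer i⁆ f + partialDer i (δ f) := by
        rw [Derivation.commutator_apply, sub_add_cancel]
      dsimp only
      rw [e, ← ha, Derivation.leibniz]
      exact add_mem (derivation_mem_tjurina _ _) (add_mem
        (Ideal.mul_mem_left _ _ (partialDer_mem_tjurina f i))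
        (Ideal.mul_mem_right _ _ (self_mem_tjurina f)))
  · rw [map_add]; exact add_mem hx hy
  · rw [smul_eq_mul, Derivation.leibniz]
    exact add_mem (Ideal.mul_mem_left _ _ hx) (Ideal.mul_mem_right _ _ hxs)

/-- A logarithmic vector field along an isolated singularity vanishes at the origin. -/
theorem logDer_coord_mem {f : Germs n} (hf : f ∈ maxIdeal n ^ 2) {N : ℕ}
    (hN : maxIdeal n ^ N ≤ tjurina f) {δ : VectorFields n} (hδ : δ ∈ logDer f)
    (i : Fin (n + 1)) : δ (coord i) ∈ maxIdeal n := by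
  by_contra hu
  rw [mem_maxIdeal_iff_not_isUnit, not_not] at hu
  -- `δ (x_i ^ (k + 1))` is `x_i ^ k` times the unit `(k + 1) δ x_i`, so membership would descend to
  -- `x_i ^ 0 = 1`.
  have key : ∀ k, coord i ^ k ∉ tjurina f := by
    intro k
    induction k with
    | zero =>
      intro h
      have := tjurina_le_maxIdeal hf h
      rw [mem_maxIdeal_iff_not_isUnit, pow_zero] at this
      exact this isUnit_one
    | succ k ih =>
      intro h
      have h1 := derivation_tjurina_stable hδ h
      rw [Derivation.leibniz_pow, Nat.add_sub_cancel, smul_eq_mul, nsmul_eq_mul] at h1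
      have hk : IsUnit (((k + 1 : ℕ) : Germs n)) := by
        rw [isUnit_iff, map_natCast]
        exact_mod_cast Nat.succ_ne_zero k
      rw [mul_comm (coord i ^ k), ← mul_assoc] at h1
      exact ih ((Ideal.unit_mul_mem_iff_mem _ (hk.mul hu)).1 h1)
  exact key N (hN (Ideal.pow_mem_pow (coord_mem i) N))

end

section

variable {n : ℕ}

/-! ### Generalised eigenvectors of a vector field modulo a power of `𝔪` -/

/-- The operator `δ - μ`. -/
def shift (δ : VectorFields n) (μ : ℂ) : Module.End ℂ (Germs n) := δ.toLinearMap - μ • 1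

theorem shift_apply (δ : VectorFields n) (μ : ℂ) (g : Germs n) : shift δ μ g = δ g - μ • g := rfl

/-- `g` is a generalised eigenvector of `δ` with eigenvalue `μ` modulo `𝔪 ^ k`. -/
def IsGen (δ : VectorFields n) (k : ℕ) (μ : ℂ) (g : Germs n) : Prop :=
  ∃ N : ℕ, (shift δ μ ^ N) g ∈ maxIdeal n ^ k

variable {δ : VectorFields n} {k : ℕ} {μ ν : ℂ} {g h : Germs n}

theorem smul_mem_pow (c : ℂ) (hg : g ∈ maxIdeal n ^ k) : c • g ∈ maxIdeal n ^ k := by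
  rw [Algebra.smul_def]; exact Ideal.mul_mem_left _ _ hg

theorem IsGen.of_mem (hg : g ∈ maxIdeal n ^ k) : IsGen δ k μ g := ⟨0, hg⟩

theorem IsGen.mono {l : ℕ} (hlk : l ≤ k) (hg : IsGen δ k μ g) : IsGen δ l μ g :=
  let ⟨N, hN⟩ := hg
  ⟨N, Ideal.pow_le_pow_right hlk hN⟩

theorem shift_mem_pow (hδ : ∀ i, δ (coord i) ∈ maxIdeal n) (μ : ℂ) (hg : g ∈ maxIdeal n ^ k) :
    shift δ μ g ∈ maxIdeal n ^ k :=
  sub_mem (derivation_mem_pow_of_coord hδ hg) (smul_mem_pow μ hg)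

theorem shift_pow_mem_pow (hδ : ∀ i, δ (coord i) ∈ maxIdeal n) (μ : ℂ) (N : ℕ)
    (hg : g ∈ maxIdeal n ^ k) :
    (shift δ μ ^ N) g ∈ maxIdeal n ^ k := by
  induction N with
  | zero => simpa using hg
  | succ N ih => rw [pow_succ', Module.End.mul_apply]; exact shift_mem_pow hδ μ ih

/-- By Leibniz, `δ - (μ + ν)` on a product is `δ - μ` on one factor plus `δ - ν` on the other; one
of the exponents `N`, `M` drops at each application. Once one is zero, stability of `𝔪 ^ k`
finishes. -/
theorem shift_pow_mul_mem (hδ : ∀ i, δ (coord i) ∈ maxIdeal n) :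
    ∀ (s N M : ℕ) (a b : Germs n), N + M = s →
    (shift δ μ ^ N) a ∈ maxIdeal n ^ k → (shift δ ν ^ M) b ∈ maxIdeal n ^ k →
    (shift δ (μ + ν) ^ s) (a * b) ∈ maxIdeal n ^ k := by
  intro s
  induction s with
  | zero =>
    intro N M a b hs ha _
    obtain ⟨rfl, rfl⟩ : N = 0 ∧ M = 0 := by omega
    exact Ideal.mul_mem_right _ _ ha
  | succ s ih =>
    intro N M a b hs ha hb
    have e : shift δ (μ + ν) (a * b) = shift δ μ a * b + a * shift δ ν b := by
      simp only [shift_apply, Derivation.leibniz, smul_eq_mul, Algebra.smul_def, map_add]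
      ring
    rcases N with _ | N
    · exact shift_pow_mem_pow hδ _ _ (Ideal.mul_mem_right _ _ ha)
    rcases M with _ | M
    · exact shift_pow_mem_pow hδ _ _ (Ideal.mul_mem_left _ _ hb)
    rw [pow_succ, Module.End.mul_apply, e, map_add]
    refine add_mem (ih N (M + 1) _ _ (by omega) ?_ hb) (ih (N + 1) M _ _ (by omega) ha ?_)
    · rwa [pow_succ, Module.End.mul_apply] at ha
    · rwa [pow_succ, Module.End.mul_apply] at hb

theorem IsGen.mul (hδ : ∀ i, δ (coord i) ∈ maxIdeal n) (hg : IsGen δ k μ g)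
    (hh : IsGen δ k ν h) : IsGen δ k (μ + ν) (g * h) :=
  let ⟨N, hN⟩ := hg
  let ⟨M, hM⟩ := hh
  ⟨N + M, shift_pow_mul_mem hδ _ N M g h rfl hN hM⟩

theorem IsGen.one : IsGen δ k 0 (1 : Germs n) := ⟨1, by simp [shift_apply]⟩

theorem IsGen.derivation (hδ : ∀ i, δ (coord i) ∈ maxIdeal n) (hg : IsGen δ k μ g) :
    IsGen δ k μ (δ g) := by
  obtain ⟨N, hN⟩ := hg
  refine ⟨N, ?_⟩
  have h1 : δ g = shift δ μ g + μ • g := by rw [shift_apply, sub_add_cancel]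
  rw [h1, map_add, map_smul, ← Module.End.mul_apply, ← pow_succ, pow_succ', Module.End.mul_apply]
  exact add_mem (shift_mem_pow hδ μ hN) (smul_mem_pow μ hN)

theorem IsGen.monomial (hδ : ∀ i, δ (coord i) ∈ maxIdeal n) {w : Fin (n + 1) → ℂ}
    (hw : ∀ i, IsGen δ k (w i) (coord i)) (α : Fin (n + 1) →₀ ℕ) :
    IsGen δ k (∑ i, α i * w i) (ofPoly n (MvPolynomial.monomial α 1)) := by
  classical
  have hpow : ∀ i (e : ℕ), IsGen δ k (e * w i) (coord i ^ e) := by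
    intro i e
    induction e with
    | zero => simpa using IsGen.one
    | succ e ih =>
      rw [pow_succ, Nat.cast_succ, add_mul, one_mul]
      exact ih.mul hδ (hw i)
  have key : ∀ s : Finset (Fin (n + 1)),
      IsGen δ k (∑ i ∈ s, α i * w i) (∏ i ∈ s, coord i ^ α i) := by
    intro s
    induction s using Finset.induction_on with
    | empty => simpa using IsGen.one
    | insert i s hi ih =>
      rw [Finset.sum_insert hi, Finset.prod_insert hi]
      exact (hpow i _).mul hδ ih
  have e : ofPoly n (MvPolynomial.monomial α 1) = ∏ i, coord i ^ α i := by
    rw [ofPoly, MvPolynomial.aeval_monomial, map_one, one_mul, Finsupp.prod_fintype]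
    simp
  rw [e]
  exact key Finset.univ

/-! ### Passage to the finite-dimensional quotient -/

/-- `𝔪 ^ k` as a complex subspace. -/
def powSubspace (n k : ℕ) : Submodule ℂ (Germs n) := (maxIdeal n ^ k).restrictScalars ℂ

theorem mem_powSubspace : g ∈ powSubspace n k ↔ g ∈ maxIdeal n ^ k := Iff.rfl

instance finite_jets (n k : ℕ) : Module.Finite ℂ (Germs n ⧸ powSubspace n k) := by
  have hfin : {α : Fin (n + 1) →₀ ℕ | α.degree < k}.Finite :=
    (Finsupp.finite_of_degree_le k).subset fun α hα => (show α.degree < k from hα).le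
  have := hfin.fintype
  let c : Germs n →ₗ[ℂ] ({α : Fin (n + 1) →₀ ℕ | α.degree < k} → ℂ) :=
    LinearMap.pi fun a => cf a.1
  have hc : LinearMap.ker c = powSubspace n k := by
    ext g
    rw [LinearMap.mem_ker, mem_powSubspace, mem_maxIdeal_pow]
    exact ⟨fun h m hm => congrFun h ⟨m, hm⟩, fun h => funext fun a => h a.1 a.2⟩
  exact Module.Finite.of_injective ((powSubspace n k).liftQ c hc.ge)
    (LinearMap.ker_eq_bot.1 (Submodule.ker_liftQ_eq_bot _ _ _ hc.le))

/-- The operator induced by `δ` on `𝒪 / 𝔪 ^ k`. -/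
def jetMap (hδ : ∀ i, δ (coord i) ∈ maxIdeal n) (k : ℕ) :
    Module.End ℂ (Germs n ⧸ powSubspace n k) :=
  (powSubspace n k).mapQ (powSubspace n k) δ.toLinearMap
    fun _ hg => derivation_mem_pow_of_coord hδ hg

theorem jetMap_mk (hδ : ∀ i, δ (coord i) ∈ maxIdeal n) (g : Germs n) :
    jetMap hδ k ((powSubspace n k).mkQ g) = (powSubspace n k).mkQ (δ g) := rfl

theorem isGen_iff (hδ : ∀ i, δ (coord i) ∈ maxIdeal n) :
    IsGen δ k μ g ↔ (powSubspace n k).mkQ g ∈ (jetMap hδ k).maxGenEigenspace μ := by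
  have key : ∀ N : ℕ, ((jetMap hδ k - μ • 1) ^ N) ((powSubspace n k).mkQ g) =
      (powSubspace n k).mkQ ((shift δ μ ^ N) g) := by
    intro N
    induction N with
    | zero => simp
    | succ N ih =>
      rw [pow_succ', Module.End.mul_apply, ih, pow_succ', Module.End.mul_apply]
      rfl
  rw [Module.End.mem_maxGenEigenspace]
  refine exists_congr fun N => ?_
  rw [key, Submodule.mkQ_apply, Submodule.Quotient.mk_eq_zero, mem_powSubspace]

/-- A `δ`-stable subspace containing `𝔪 ^ k` is spanned by generalised eigenvectors. -/
theorem le_span_isGen (hδ : ∀ i, δ (coord i) ∈ maxIdeal n) {W : Submodule ℂ (Germs n)}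
    (hW : ∀ w ∈ W, δ w ∈ W) (hk : powSubspace n k ≤ W) :
    W ≤ Submodule.span ℂ {w | w ∈ W ∧ ∃ μ, IsGen δ k μ w} := by
  intro w hw
  set S := {w | w ∈ W ∧ ∃ μ, IsGen δ k μ w} with hS
  -- Over `ℂ` the jet space is the sum of its generalised eigenspaces, and this decomposition
  -- restricts to invariant subspaces.
  have h1 := Submodule.eq_iSup_inf_genEigenspace (p := W.map (powSubspace n k).mkQ)
    (f := jetMap hδ k) ⊤ (by
      rintro _ ⟨x, hx, rfl⟩
      rw [jetMap_mk]
      exact Submodule.mem_map_of_mem (hW x hx)) (Module.End.iSup_maxGenEigenspace_eq_top _)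
  have h2 : W.map (powSubspace n k).mkQ ≤ (Submodule.span ℂ S).map (powSubspace n k).mkQ := by
    rw [h1]
    refine iSup_le fun μ => ?_
    rintro _ ⟨⟨x, hx, rfl⟩, hx'⟩
    exact Submodule.mem_map_of_mem (Submodule.subset_span ⟨hx, μ, (isGen_iff hδ).2 hx'⟩)
  obtain ⟨x, hx, hxw⟩ := h2 (Submodule.mem_map_of_mem hw)
  have h3 : w - x ∈ powSubspace n k := by
    rw [← Submodule.Quotient.mk_eq_zero, Submodule.Quotient.mk_sub, sub_eq_zero]
    exact hxw.symm
  rw [← sub_add_cancel w x]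
  exact add_mem (Submodule.subset_span ⟨hk h3, 0, IsGen.of_mem h3⟩) hx

/-- If the coordinates are generalised eigenvectors, then the monomials occurring in a generalised
eigenvector all have its eigenvalue as their weight. -/
theorem IsGen.weight_eq (hδ : ∀ i, δ (coord i) ∈ maxIdeal n) {w : Fin (n + 1) → ℂ}
    (hw : ∀ i, IsGen δ k (w i) (coord i)) (hg : IsGen δ k μ g) {α : Fin (n + 1) →₀ ℕ}
    (hα : α.degree < k) (hne : cf α g ≠ 0) : ∑ i, α i * w i = μ := by
  classical
  by_contra hcon
  set ν := ∑ i, α i * w i with hν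
  set π := (powSubspace n k).mkQ with hπ
  set A := (jet k g).support with hA
  let t : (Fin (n + 1) →₀ ℕ) → Germs n := fun β =>
    (jet k g).coeff β • ofPoly n (MvPolynomial.monomial β 1)
  have hsum : ∑ β ∈ A, t β = ofPoly n (jet k g) := by
    conv_rhs => rw [(jet k g).as_sum, map_sum]
    refine Finset.sum_congr rfl fun β _ => ?_
    rw [show t β = _ from (map_smul (ofPoly n) _ _).symm, MvPolynomial.smul_monomial, smul_eq_mul,
      mul_one]
  have hπg : π g = ∑ β ∈ A with ∑ i, β i * w i = ν, π (t β) +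
      ∑ β ∈ A with ¬ ∑ i, β i * w i = ν, π (t β) := by
    rw [Finset.sum_filter_add_sum_filter_not, ← map_sum, hsum, ← sub_eq_zero, ← map_sub]
    exact (Submodule.Quotient.mk_eq_zero _).2 (sub_ofPoly_jet_mem k g)
  have hmem : ∀ β, π (t β) ∈ (jetMap hδ k).maxGenEigenspace (∑ i, β i * w i) := by
    intro β
    rw [map_smul]
    exact Submodule.smul_mem _ _ ((isGen_iff hδ).1 (IsGen.monomial hδ hw β))
  have h1 : ∑ β ∈ A with ∑ i, β i * w i = ν, π (t β) ∈ (jetMap hδ k).maxGenEigenspace ν :=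
    sum_mem fun β hβ => by
      have := hmem β
      rwa [(Finset.mem_filter.1 hβ).2] at this
  have hle : ∀ κ, κ ≠ ν → (jetMap hδ k).maxGenEigenspace κ ≤
      ⨆ (j) (_ : j ≠ ν), (jetMap hδ k).maxGenEigenspace j := fun κ hκ =>
    le_iSup₂_of_le κ hκ le_rfl
  -- The weight-`ν` part of `g` lies in the eigenspace of `ν` and, being `g` minus the other parts,
  -- in the sum of the remaining ones. Independence makes it zero modulo `𝔪 ^ k`, against `cf α g ≠
  -- 0`.
  have h2 : ∑ β ∈ A with ∑ i, β i * w i = ν, π (t β) ∈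
      ⨆ (j) (_ : j ≠ ν), (jetMap hδ k).maxGenEigenspace j := by
    rw [eq_sub_of_add_eq hπg.symm]
    exact sub_mem (hle μ (Ne.symm hcon) ((isGen_iff hδ).1 hg))
      (sum_mem fun β hβ => hle _ (Finset.mem_filter.1 hβ).2 (hmem β))
  have h3 := Submodule.disjoint_def.1
    ((jetMap hδ k).independent_maxGenEigenspace ν) _ h1 h2
  rw [← map_sum] at h3
  have h4 := mem_maxIdeal_pow.1 ((Submodule.Quotient.mk_eq_zero _).1 h3) α hα
  have hcoef : ∀ β, cf α (t β) = if β = α then (jet k g).coeff α else 0 := by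
    intro β
    rw [map_smul, cf_ofPoly, MvPolynomial.coeff_monomial]
    split_ifs with h <;> simp [h]
  have hjet : (jet k g).coeff α = cf α g := by rw [coeff_jet, if_pos hα]
  have hαA : α ∈ A := by rw [hA, MvPolynomial.mem_support_iff, hjet]; exact hne
  rw [map_sum] at h4
  simp_rw [hcoef] at h4
  rw [Finset.sum_ite_eq', if_pos (Finset.mem_filter.2 ⟨hαA, hν.symm⟩), hjet] at h4
  exact hne h4

/-! ### Eigencoordinates and an eigenequation -/

/-- Generalised eigenvectors span `𝔪`, so their linear parts span `ℂ^{n+1}` and contain a basis. -/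
theorem exists_isGen_coordinates (hδ : ∀ i, δ (coord i) ∈ maxIdeal n) (hk : 2 ≤ k) :
    ∃ (y : Fin (n + 1) → Germs n) (w : Fin (n + 1) → ℂ), (∀ i, y i ∈ maxIdeal n) ∧
      IsUnit (jac y) ∧ ∀ i, IsGen δ k (w i) (y i) := by
  have hspan := le_span_isGen (k := k) hδ (W := powSubspace n 1)
    (fun w hw => derivation_mem_pow_of_coord hδ hw)
    (fun g hg => Ideal.pow_le_pow_right (by omega) hg)
  set S := {w | w ∈ powSubspace n 1 ∧ ∃ μ, IsGen δ k μ w} with hS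
  let lin : Germs n →ₗ[ℂ] (Fin (n + 1) → ℂ) := LinearMap.pi fun j => cf (Finsupp.single j 1)
  have htop : Submodule.span ℂ (lin '' S) = ⊤ := by
    rw [← Submodule.map_span, eq_top_iff]
    intro v _
    refine ⟨∑ j, v j • coord j, hspan (sum_mem fun j _ => ?_), ?_⟩
    · exact Submodule.smul_mem _ _ (by
        rw [mem_powSubspace, pow_one]; exact coord_mem j)
    · funext j
      change cf _ _ = _
      simp [cf_single_coord]
  obtain ⟨b, hb, -, hli⟩ := Submodule.exists_fun_fin_finrank_span_eq ℂ (lin '' S)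
  have hdim : n + 1 = Module.finrank ℂ (Submodule.span ℂ (lin '' S)) := by
    rw [htop, finrank_top]; simp
  choose y hyS hyb using fun i : Fin (n + 1) => hb (Fin.cast hdim i)
  choose hym w hw using hyS
  refine ⟨y, w, fun i => by simpa [mem_powSubspace] using hym i, ?_, hw⟩
  rw [← Matrix.linearIndependent_rows_iff_isUnit]
  have : (jac y).row = b ∘ Fin.cast hdim := by
    funext i
    exact hyb i
  rw [this]
  exact hli.comp _ (Fin.cast_injective hdim)

/-- The `δ`-stable space `(f) + 𝔪 ^ k` is spanned by generalised eigenvectors `c f + h` with `h ∈ 𝔪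
^ k`. If no `c` were a unit, `f` would lie in `𝔪 f + 𝔪 ^ k`, hence in `𝔪 ^ k`. -/
theorem exists_unit_isGen (hδ : ∀ i, δ (coord i) ∈ maxIdeal n) {f a : Germs n} (ha : δ f = a * f)
    (hf : f ∉ maxIdeal n ^ k) : ∃ u : (Germs n)ˣ, IsGen δ k (evalZero n a) (u * f) := by
  set W : Submodule ℂ (Germs n) := (Ideal.span {f} ⊔ maxIdeal n ^ k).restrictScalars ℂ with hW
  have hmemW : ∀ {w}, w ∈ W ↔ ∃ c h, h ∈ maxIdeal n ^ k ∧ w = c * f + h := by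
    intro w
    rw [hW, Submodule.restrictScalars_mem, Submodule.mem_sup]
    constructor
    · rintro ⟨x, hx, h, hh, rfl⟩
      obtain ⟨c, rfl⟩ := Ideal.mem_span_singleton'.1 hx
      exact ⟨c, h, hh, rfl⟩
    · rintro ⟨c, h, hh, rfl⟩
      exact ⟨_, Ideal.mem_span_singleton'.2 ⟨c, rfl⟩, h, hh, rfl⟩
  have hspan := le_span_isGen (k := k) hδ (W := W) (by
      intro w hw
      obtain ⟨c, h, hh, rfl⟩ := hmemW.1 hw
      refine hmemW.2 ⟨c * a + δ c, δ h, derivation_mem_pow_of_coord hδ hh, ?_⟩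
      rw [map_add, Derivation.leibniz, ha, smul_eq_mul, smul_eq_mul]
      ring) (fun h hh => hmemW.2 ⟨0, h, hh, by ring⟩)
  obtain ⟨c, μ, hc, hμ⟩ : ∃ c μ, IsUnit c ∧ IsGen δ k μ (c * f) := by
    by_contra! hcon
    set I : Submodule ℂ (Germs n) :=
      (maxIdeal n * Ideal.span {f} ⊔ maxIdeal n ^ k).restrictScalars ℂ with hI
    have hle : Submodule.span ℂ {w | w ∈ W ∧ ∃ μ, IsGen δ k μ w} ≤ I := by
      rw [Submodule.span_le]
      rintro _ ⟨hw, μ, hμ⟩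
      obtain ⟨c, h, hh, rfl⟩ := hmemW.1 hw
      have hcf : IsGen δ k μ (c * f) := by
        have := sub_mem ((isGen_iff hδ).1 hμ) ((isGen_iff hδ).1 (IsGen.of_mem (μ := μ) hh))
        rwa [← map_sub, add_sub_cancel_right, ← isGen_iff] at this
      have hcm : c ∈ maxIdeal n := by
        rw [mem_maxIdeal_iff_not_isUnit]
        exact fun hu => hcon c μ hu hcf
      exact add_mem (Submodule.mem_sup_left (Ideal.mul_mem_mul hcm
        (Ideal.mem_span_singleton_self f))) (Submodule.mem_sup_right hh)
    have hfI := hle (hspan (hmemW.2 ⟨1, 0, zero_mem _, by ring⟩ : f ∈ W))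
    rw [hI, Submodule.restrictScalars_mem, Submodule.mem_sup] at hfI
    obtain ⟨x, hx, h, hh, e⟩ := hfI
    obtain ⟨c, hc, rfl⟩ := Ideal.mem_mul_span_singleton.1 hx
    have h1 : (1 - c) * f ∈ maxIdeal n ^ k := by
      have : (1 - c) * f = h := by linear_combination -e
      rwa [this]
    exact hf ((Ideal.unit_mul_mem_iff_mem _ (isUnit_one_sub hc)).1 h1)
  have hμa : μ = evalZero n a := by
    by_contra hne
    -- `(δ - μ)(c f) = (δ c + (a - μ) c) f`, whose coefficient stays a unit when `μ ≠ a(0)`; such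
    -- iterates never reach `𝔪 ^ k`.
    have key : ∀ N : ℕ, ∃ c, IsUnit c ∧ (shift δ μ ^ N) (hc.unit * f) = c * f := by
      intro N
      induction N with
      | zero => exact ⟨c, hc, rfl⟩
      | succ N ih =>
        obtain ⟨c', hc', e⟩ := ih
        refine ⟨δ c' + (a - algebraMap ℂ _ μ) * c', ?_, ?_⟩
        · have h0 : evalZero n (δ c') = 0 := by
            rw [← mem_maxIdeal, derivation_apply]
            exact sum_mem fun i _ => Ideal.mul_mem_right _ _ (hδ i)
          rw [isUnit_iff, map_add, h0, zero_add, map_mul, map_sub, evalZero_algebraMap]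
          exact mul_ne_zero (sub_ne_zero.2 (Ne.symm hne)) (isUnit_iff.1 hc')
        · rw [pow_succ', Module.End.mul_apply, e, shift_apply, Derivation.leibniz, ha,
            Algebra.smul_def μ, smul_eq_mul, smul_eq_mul]
          ring
    obtain ⟨N, hN⟩ := hμ
    obtain ⟨c', hc', e⟩ := key N
    have hN' : (shift δ μ ^ N) (hc.unit * f) ∈ maxIdeal n ^ k := hN
    rw [e] at hN'
    exact hf ((Ideal.unit_mul_mem_iff_mem _ hc').1 hN')
  exact ⟨hc.unit, hμa ▸ hμ⟩

end

section

variable {n : ℕ}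

/-! ### Linear parts and traces -/

theorem linearPart_apply (δ : VectorFields n) (i j : Fin (n + 1)) :
    linearPart δ i j = cf (Finsupp.single j 1) (δ (coord i)) := rfl

theorem evalZero_partialDer (i : Fin (n + 1)) (g : Germs n) :
    evalZero n (partialDer i g) = cf (Finsupp.single i 1) g := by
  rw [← cf_zero, cf_partialDer]
  simp

theorem cf_single_derivation {δ : VectorFields n} (hδ : ∀ i, δ (coord i) ∈ maxIdeal n)
    (g : Germs n) (j : Fin (n + 1)) :
    cf (Finsupp.single j 1) (δ g) = ∑ i, cf (Finsupp.single i 1) g * linearPart δ i j := by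
  rw [derivation_apply, map_sum]
  refine Finset.sum_congr rfl fun i _ => ?_
  rw [cf_single_mul, mem_maxIdeal.1 (hδ i), zero_mul, zero_add, evalZero_partialDer,
    linearPart_apply]

/-- If the coordinates are generalised eigenvectors of `δ`, then the trace of the linear part is
the sum of the eigenvalues. -/
theorem trace_linearPart_eq_sum {δ : VectorFields n} (hδ : ∀ i, δ (coord i) ∈ maxIdeal n)
    {k : ℕ} (hk : 2 ≤ k) {w : Fin (n + 1) → ℂ} (hw : ∀ i, IsGen δ k (w i) (coord i)) :
    (linearPart δ).trace = ∑ i, w i := by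
  classical
  have hw2 : ∀ i, IsGen δ 2 (w i) (coord i) := fun i => (hw i).mono hk
  -- It suffices that `N` is nilpotent: row `i` of `N ^ t` is the linear part of `(δ - w_i)^t x_i`.
  set N := linearPart δ - Matrix.diagonal w with hN
  have hgen : ∀ (i : Fin (n + 1)) (t : ℕ), IsGen δ 2 (w i) ((shift δ (w i) ^ t) (coord i)) := by
    intro i t
    induction t with
    | zero => exact hw2 i
    | succ t ih =>
      obtain ⟨s, hs⟩ := ih
      refine ⟨s, ?_⟩
      rw [← Module.End.mul_apply, ← pow_add] at hs ⊢
      rw [← add_assoc s t 1, pow_succ' _ (s + t), Module.End.mul_apply]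
      exact shift_mem_pow hδ _ hs
  have hrow : ∀ (i : Fin (n + 1)) (t : ℕ) j,
      cf (Finsupp.single j 1) ((shift δ (w i) ^ t) (coord i)) = (N ^ t) i j := by
    intro i t
    induction t with
    | zero => intro j; simp [cf_single_coord, Matrix.one_apply, eq_comm]
    | succ t ih =>
      intro j
      rw [pow_succ', Module.End.mul_apply, shift_apply, map_sub, cf_single_derivation hδ, map_smul,
        pow_succ, Matrix.mul_apply]
      simp only [ih, hN, Matrix.sub_apply, mul_sub, Finset.sum_sub_distrib, smul_eq_mul]
      congr 1
      rw [Finset.sum_eq_single j (fun l _ hl => by simp [Matrix.diagonal_apply_ne _ hl]) (by simp),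
        Matrix.diagonal_apply_eq]
      -- A nonzero entry forces `w j = w i` by `IsGen.weight_eq`, so multiplying by the diagonal
      -- matrix on the right amounts to scaling the row by `w i`.
      by_cases h0 : (N ^ t) i j = 0
      · rw [← hN, h0, zero_mul, mul_zero]
      · have h1 := (hgen i t).weight_eq hδ hw2 (α := Finsupp.single j 1) (by simp)
          (by rwa [ih])
        have h2 : w j = w i := by
          rw [← h1]
          simp [Finsupp.single_apply]
        rw [h2, mul_comm]
  have hnil : ∃ t, ∀ i, (shift δ (w i) ^ t) (coord i) ∈ maxIdeal n ^ 2 := by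
    choose t ht using hw2
    refine ⟨∑ i, t i, fun i => ?_⟩
    obtain ⟨s, hs⟩ := Nat.exists_eq_add_of_le (Finset.single_le_sum (f := t)
      (fun _ _ => Nat.zero_le _) (Finset.mem_univ i))
    rw [hs, add_comm (t i), pow_add, Module.End.mul_apply]
    exact shift_pow_mem_pow hδ _ _ (ht i)
  obtain ⟨t, ht⟩ := hnil
  have hN0 : IsNilpotent N := ⟨t, by
    ext i j
    rw [← hrow, Matrix.zero_apply]
    exact cf_single_of_mem_sq (ht i) j⟩
  have h3 := (Matrix.isNilpotent_trace_of_isNilpotent hN0).eq_zero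
  rw [hN, Matrix.trace_sub, Matrix.trace_diagonal, sub_eq_zero] at h3
  exact h3

theorem cf_single_algHom (ψ : Germs n →ₐ[ℂ] Germs n) {g : Germs n} (hg : g ∈ maxIdeal n)
    (j : Fin (n + 1)) : cf (Finsupp.single j 1) (ψ g) =
      ∑ i, cf (Finsupp.single i 1) g * jac (fun i => ψ (coord i)) i j := by
  have h1 := cf_single_of_mem_sq (algHom_mem_maxIdeal_pow ψ (sub_linear_mem_sq hg)) j
  rw [map_sub, map_sub, sub_eq_zero, map_sum, map_sum] at h1
  rw [h1]
  refine Finset.sum_congr rfl fun i _ => ?_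
  rw [map_smul, map_smul, smul_eq_mul]
  rfl

theorem conjDer_coord_mem (φ : Germs n ≃ₐ[ℂ] Germs n) {δ : VectorFields n}
    (hδ : ∀ i, δ (coord i) ∈ maxIdeal n) (i : Fin (n + 1)) :
    conjDer φ δ (coord i) ∈ maxIdeal n := by
  rw [conjDer_apply]
  refine algHom_mem_maxIdeal (φ : Germs n →ₐ[ℂ] Germs n) ?_
  have h1 : φ.symm (coord i) ∈ maxIdeal n ^ 1 := by
    rw [pow_one]
    exact algHom_mem_maxIdeal (φ.symm : Germs n →ₐ[ℂ] Germs n) (coord_mem i)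
  simpa using derivation_mem_pow_of_coord hδ h1

theorem trace_linearPart_conjDer (φ : Germs n ≃ₐ[ℂ] Germs n) {δ : VectorFields n}
    (hδ : ∀ i, δ (coord i) ∈ maxIdeal n) (hφ : IsUnit (jac fun i => φ.symm (coord i))) :
    (linearPart (conjDer φ δ)).trace = (linearPart δ).trace := by
  set P := jac fun i => φ.symm (coord i) with hP
  have h1 : linearPart (conjDer φ δ) * P = P * linearPart δ := by
    ext i j
    rw [Matrix.mul_apply, Matrix.mul_apply]
    have h2 := cf_single_algHom (φ.symm : Germs n →ₐ[ℂ] Germs n) (conjDer_coord_mem φ hδ i) j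
    have h3 : (φ.symm : Germs n →ₐ[ℂ] Germs n) (conjDer φ δ (coord i)) = δ (φ.symm (coord i)) :=
      φ.symm_apply_apply _
    rw [h3, cf_single_derivation hδ] at h2
    exact h2.symm
  obtain ⟨P', hP'⟩ := hφ
  rw [← hP'] at h1
  have h4 : linearPart (conjDer φ δ) = P'.1 * linearPart δ * P'.2 := by
    rw [← h1, Matrix.mul_assoc, P'.val_inv, Matrix.mul_one]
  rw [h4, Matrix.trace_mul_comm, ← Matrix.mul_assoc, P'.inv_val, Matrix.one_mul]

theorem IsGen.conjDer (φ : Germs n ≃ₐ[ℂ] Germs n) {δ : VectorFields n} {k : ℕ} {μ : ℂ}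
    {g : Germs n} (hg : IsGen δ k μ g) : IsGen (conjDer φ δ) k μ (φ g) := by
  have key : ∀ N : ℕ, (shift (LogVF.conjDer φ δ) μ ^ N) (φ g) = φ ((shift δ μ ^ N) g) := by
    intro N
    induction N with
    | zero => rfl
    | succ N ih =>
      rw [pow_succ', Module.End.mul_apply, ih, pow_succ', Module.End.mul_apply, shift_apply,
        conjDer_apply, AlgEquiv.symm_apply_apply, shift_apply, map_sub, map_smul]
  obtain ⟨N, hN⟩ := hg
  refine ⟨N, ?_⟩
  rw [key]
  exact algHom_mem_maxIdeal_pow (φ : Germs n →ₐ[ℂ] Germs n) hN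

/-! ### Counting variables -/

theorem ofPoly_monomial_mem {I : Ideal (Germs n)} {i : Fin (n + 1)} (hi : coord i ∈ I)
    {α : Fin (n + 1) →₀ ℕ} (hα : α i ≠ 0) (c : ℂ) :
    ofPoly n (MvPolynomial.monomial α c) ∈ I := by
  have h1 : Finsupp.single i 1 ≤ α := by
    rw [Finsupp.single_le_iff]; exact Nat.one_le_iff_ne_zero.2 hα
  have e : MvPolynomial.monomial α c =
      MvPolynomial.monomial (α - Finsupp.single i 1) c * MvPolynomial.X i := by
    rw [MvPolynomial.X, MvPolynomial.monomial_mul, tsub_add_cancel_of_le h1, mul_one]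
  rw [e, map_mul]
  refine Ideal.mul_mem_left _ _ ?_
  rwa [ofPoly, MvPolynomial.aeval_X]

theorem mem_sup_of_forall_monomial {I : Ideal (Germs n)} {S : Finset (Fin (n + 1))}
    (hI : ∀ i ∉ S, coord i ∈ I) {l : ℕ} {g : Germs n}
    (h : ∀ α : Fin (n + 1) →₀ ℕ, α.degree < l → cf α g ≠ 0 → ∃ i ∉ S, α i ≠ 0) :
    g ∈ I ⊔ maxIdeal n ^ l := by
  rw [← add_sub_cancel (ofPoly n (jet l g)) g]
  refine Submodule.add_mem_sup ?_ (sub_ofPoly_jet_mem l g)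
  rw [(jet l g).as_sum, map_sum]
  refine sum_mem fun α hα => ?_
  rw [MvPolynomial.mem_support_iff, coeff_jet] at hα
  have hd : α.degree < l := by
    by_contra hcon
    exact hα (if_neg hcon)
  rw [if_pos hd] at hα
  obtain ⟨i, hi, hi'⟩ := h α hd hα
  exact ofPoly_monomial_mem (hI i hi) hi' _

/-- If `f` vanishes on the coordinate subspace spanned by `S` and all partial derivatives except
those in `Q` vanish there as well (up to high order), then `Q` has at least as many elements as
`S`. -/
theorem card_le_card_of_monomials {f : Germs n} (hf : f ∈ maxIdeal n ^ 2) {N k : ℕ}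
    (hN : maxIdeal n ^ N ≤ tjurina f) (hk : N + 2 ≤ k) {S Q : Finset (Fin (n + 1))}
    (h1 : ∀ α : Fin (n + 1) →₀ ℕ, α.degree < k → cf α f ≠ 0 → ∃ i ∉ S, α i ≠ 0)
    (h2 : ∀ j ∉ Q, ∀ α : Fin (n + 1) →₀ ℕ, α.degree + 1 < k →
      cf (α + Finsupp.single j 1) f ≠ 0 → ∃ i ∉ S, α i ≠ 0) : S.card ≤ Q.card := by
  classical
  -- These `n + 1 - |S| + |Q|` germs generate the Tjurina ideal modulo `𝔪 ^ (N + 1)` and the extra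
  -- coordinates; Nakayama removes the error, and at least `n + 1` generators are needed.
  let g : {i // i ∉ S} ⊕ {j // j ∈ Q} → Germs n :=
    Sum.elim (fun i => coord i.1) (fun j => partialDer j.1 f)
  set I := Ideal.span (Set.range g) with hI
  have hIS : ∀ i ∉ S, coord i ∈ I := fun i hi => Ideal.subset_span ⟨Sum.inl ⟨i, hi⟩, rfl⟩
  have hle : tjurina f ≤ I ⊔ maxIdeal n ^ (N + 1) := by
    rw [tjurina_le]
    refine ⟨mem_sup_of_forall_monomial hIS fun α hα => h1 α (by omega), fun j => ?_⟩
    by_cases hj : j ∈ Q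
    · exact Ideal.mem_sup_left (Ideal.subset_span ⟨Sum.inr ⟨j, hj⟩, rfl⟩)
    · refine mem_sup_of_forall_monomial hIS fun α hα hne => h2 j hj α (by omega) fun h0 => hne ?_
      rw [cf_partialDer, h0, zero_mul]
  have h3 := le_card_of_pow_le_span g (fun i => by
    rcases i with i | j
    · exact coord_mem _
    · have := derivation_mem_pow (partialDer j.1) (k := 1) hf
      rwa [pow_one] at this)
    (maxIdeal_pow_le_of_le_sup (Nat.lt_succ_self N) (hN.trans hle))
  have h4 : Fintype.card {i // i ∉ S} = n + 1 - S.card := by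
    rw [Fintype.card_subtype_compl]
    simp
  have h5 : S.card ≤ n + 1 := by simpa using Finset.card_le_univ S
  rw [Fintype.card_sum, h4, Fintype.card_coe] at h3
  omega

/-- Layer cake: the sum of the positive parts is the integral of `#{i | c ≤ w i}` over `c > 0`, and
likewise for the negative parts. -/
theorem sum_eq_zero_of_card_eq {ι : Type*} [Fintype ι] {w : ι → ℝ}
    (h : ∀ c, 0 < c → (Finset.univ.filter fun i => c ≤ w i).card =
      (Finset.univ.filter fun i => w i ≤ -c).card) : ∑ i, w i = 0 := by
  classical
  have key : ∀ v : ι → ℝ, ∑ i, ENNReal.ofReal (v i) =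
      ∫⁻ c in Set.Ioi (0 : ℝ), ((Finset.univ.filter fun i => c ≤ v i).card : ℝ≥0∞) := by
    intro v
    have h1 : ∀ i, ENNReal.ofReal (v i) =
        ∫⁻ c in Set.Ioi (0 : ℝ), (Set.Iic (v i)).indicator 1 c := by
      intro i
      rw [MeasureTheory.lintegral_indicator_one measurableSet_Iic,
        MeasureTheory.Measure.restrict_apply measurableSet_Iic, Set.inter_comm,
        Set.Ioi_inter_Iic, Real.volume_Ioc, sub_zero]
    simp_rw [h1]
    rw [← MeasureTheory.lintegral_finsetSum' _ fun i _ =>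
      (measurable_one.indicator measurableSet_Iic).aemeasurable]
    refine MeasureTheory.lintegral_congr fun c => ?_
    rw [Finset.card_filter, Nat.cast_sum]
    refine Finset.sum_congr rfl fun i _ => ?_
    by_cases hc : c ≤ v i <;> simp [hc]
  have h2 : ∑ i, ENNReal.ofReal (w i) = ∑ i, ENNReal.ofReal (-w i) := by
    rw [key w, key fun i => -w i]
    refine MeasureTheory.setLIntegral_congr_fun measurableSet_Ioi fun c hc => ?_
    rw [h c hc]
    simp only [le_neg]
  have h3 := congrArg ENNReal.toReal h2
  rw [ENNReal.toReal_sum (fun _ _ => ENNReal.ofReal_ne_top),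
    ENNReal.toReal_sum (fun _ _ => ENNReal.ofReal_ne_top)] at h3
  simp only [ENNReal.toReal_ofReal'] at h3
  rw [← sub_eq_zero, ← Finset.sum_sub_distrib] at h3
  rw [← h3]
  refine Finset.sum_congr rfl fun i _ => ?_
  rcases le_total (w i) 0 with h0 | h0
  · rw [max_eq_right h0, max_eq_left (by linarith)]; ring
  · rw [max_eq_left h0, max_eq_right (by linarith)]; ring

/-! ### Symmetry and positivity of the weights -/

section weights
variable {f : Germs n} {N k : ℕ} {w : Fin (n + 1) → ℝ}

theorem cf_eq_zero_of_degree_lt_two (hf : f ∈ maxIdeal n ^ 2) {α : Fin (n + 1) →₀ ℕ}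
    (hne : cf α f ≠ 0) : 2 ≤ α.degree := by
  by_contra hcon
  exact hne (mem_maxIdeal_pow.1 hf α (by omega))

theorem le_weight {α : Fin (n + 1) →₀ ℕ} {c : ℝ} (h : ∀ i, α i ≠ 0 → c ≤ w i) :
    α.degree * c ≤ ∑ i, α i * w i := by
  rw [Finsupp.degree_eq_sum, Nat.cast_sum, Finset.sum_mul]
  refine Finset.sum_le_sum fun i _ => ?_
  by_cases hi : α i = 0
  · simp [hi]
  · exact mul_le_mul_of_nonneg_left (h i hi) (Nat.cast_nonneg _)

theorem weight_le {α : Fin (n + 1) →₀ ℕ} {c : ℝ} (h : ∀ i, α i ≠ 0 → w i ≤ c) :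
    ∑ i, α i * w i ≤ α.degree * c := by
  rw [Finsupp.degree_eq_sum, Nat.cast_sum, Finset.sum_mul]
  refine Finset.sum_le_sum fun i _ => ?_
  by_cases hi : α i = 0
  · simp [hi]
  · exact mul_le_mul_of_nonneg_left (h i hi) (Nat.cast_nonneg _)

theorem weight_add_single (α : Fin (n + 1) →₀ ℕ) (j : Fin (n + 1)) :
    ∑ i, ((α + Finsupp.single j 1 : Fin (n + 1) →₀ ℕ) i : ℝ) * w i = ∑ i, α i * w i + w j := by
  classical
  simp [add_mul, Finset.sum_add_distrib, Finsupp.single_apply]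

/-- Nonconstant monomials in variables of weight at least `c` have weight at least `c`, so they
cannot occur in `f`, and multiplying by `x_j` restores weight zero only if `w j ≤ -c`. -/
theorem card_le_card_of_weight_zero (hf : f ∈ maxIdeal n ^ 2) (hN : maxIdeal n ^ N ≤ tjurina f)
    (hk : N + 2 ≤ k)
    (hw : ∀ α : Fin (n + 1) →₀ ℕ, α.degree < k → cf α f ≠ 0 → ∑ i, α i * w i = 0)
    {c : ℝ} (hc : 0 < c) : (Finset.univ.filter fun i => c ≤ w i).card ≤
      (Finset.univ.filter fun i => w i ≤ -c).card := by
  refine card_le_card_of_monomials hf hN hk (fun α hα hne => ?_) (fun j hj α hα hne => ?_)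
  · by_contra! hcon
    have h1 := le_weight (w := w) (α := α) (c := c) fun i hi => by
      by_contra hlt
      exact hi (hcon i (by simpa using hlt))
    have h2 := cf_eq_zero_of_degree_lt_two hf hne
    rw [hw α hα hne] at h1
    have h3 : (2 : ℝ) ≤ α.degree := by exact_mod_cast h2
    nlinarith
  · by_contra! hcon
    have h1 := le_weight (w := w) (α := α) (c := c) fun i hi => by
      by_contra hlt
      exact hi (hcon i (by simpa using hlt))
    have h2 := cf_eq_zero_of_degree_lt_two hf hne
    rw [map_add, Finsupp.degree_single] at h2
    have h3 : (1 : ℝ) ≤ α.degree := by exact_mod_cast (by omega : 1 ≤ α.degree)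
    have h4 := hw _ (by rwa [map_add, Finsupp.degree_single]) hne
    rw [weight_add_single] at h4
    refine hj (Finset.mem_filter.2 ⟨Finset.mem_univ _, ?_⟩)
    nlinarith

theorem sum_weight_eq_zero (hf : f ∈ maxIdeal n ^ 2) (hN : maxIdeal n ^ N ≤ tjurina f)
    (hk : N + 2 ≤ k)
    (hw : ∀ α : Fin (n + 1) →₀ ℕ, α.degree < k → cf α f ≠ 0 → ∑ i, α i * w i = 0) :
    ∑ i, w i = 0 := by
  refine sum_eq_zero_of_card_eq fun c hc => le_antisymm
    (card_le_card_of_weight_zero hf hN hk hw hc) ?_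
  have := card_le_card_of_weight_zero (w := fun i => -w i) hf hN hk (fun α hα hne => by
    simpa using hw α hα hne) hc
  simpa only [le_neg, neg_le_neg_iff] using this

/-- If the monomials of `f` have weight one and the quadratic ones only involve variables of weight
one half, then all weights are positive. -/
theorem weight_pos (hf : f ∈ maxIdeal n ^ 2) (hN : maxIdeal n ^ N ≤ tjurina f)
    (hk : N + 2 ≤ k)
    (hw : ∀ α : Fin (n + 1) →₀ ℕ, α.degree < k → cf α f ≠ 0 → ∑ i, α i * w i = 1)
    (hq : ∀ i j, cf (Finsupp.single i 1 + Finsupp.single j 1) f ≠ 0 → w i = 1 / 2)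
    (i : Fin (n + 1)) : 0 < w i := by
  -- Outside the variables of weight `1/2` the cofactor of `x_j` has degree at least two. This
  -- doubles `c` in the estimates below.
  have hdeg : ∀ (j : Fin (n + 1)) (α : Fin (n + 1) →₀ ℕ),
      cf (α + Finsupp.single j 1) f ≠ 0 → (∀ i, α i ≠ 0 → w i ≠ 1 / 2) → 2 ≤ α.degree := by
    intro j α hne hα
    have h2 := cf_eq_zero_of_degree_lt_two hf hne
    rw [map_add, Finsupp.degree_single] at h2
    by_contra hlt
    obtain ⟨i, rfl⟩ := exists_eq_single_of_degree_eq_one (m := α) (by omega)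
    exact hα i (by simp) (hq i j hne)
  have hneg : ∀ c : ℝ, 0 ≤ c → (Finset.univ.filter fun i => w i ≤ -c).card ≤
      (Finset.univ.filter fun i => 1 + 2 * c ≤ w i).card := by
    intro c hc
    refine card_le_card_of_monomials hf hN hk (fun α hα hne => ?_) (fun j hj α hα hne => ?_)
    · by_contra! hcon
      have h1 := weight_le (w := w) (α := α) (c := -c) fun i hi => by
        by_contra hlt
        exact hi (hcon i (by simpa using hlt))
      rw [hw α hα hne] at h1
      have h3 : (0 : ℝ) ≤ α.degree := Nat.cast_nonneg _
      nlinarith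
    · by_contra! hcon
      have hS : ∀ i, α i ≠ 0 → w i ≤ -c := fun i hi => by
        by_contra hlt
        exact hi (hcon i (by simpa using hlt))
      have h1 := weight_le (w := w) (α := α) (c := -c) hS
      have h3 : (2 : ℝ) ≤ α.degree := by
        exact_mod_cast hdeg j α hne fun i hi => by have := hS i hi; intro; linarith
      have h4 := hw _ (by rwa [map_add, Finsupp.degree_single]) hne
      rw [weight_add_single] at h4
      refine hj (Finset.mem_filter.2 ⟨Finset.mem_univ _, ?_⟩)
      nlinarith
  have hpos : ∀ c : ℝ, 1 ≤ c → (Finset.univ.filter fun i => c ≤ w i).card ≤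
      (Finset.univ.filter fun i => w i ≤ 1 - 2 * c).card := by
    intro c hc
    refine card_le_card_of_monomials hf hN hk (fun α hα hne => ?_) (fun j hj α hα hne => ?_)
    · by_contra! hcon
      have h1 := le_weight (w := w) (α := α) (c := c) fun i hi => by
        by_contra hlt
        exact hi (hcon i (by simpa using hlt))
      rw [hw α hα hne] at h1
      have h3 : (2 : ℝ) ≤ α.degree := by exact_mod_cast cf_eq_zero_of_degree_lt_two hf hne
      nlinarith
    · by_contra! hcon
      have hS : ∀ i, α i ≠ 0 → c ≤ w i := fun i hi => by
        by_contra hlt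
        exact hi (hcon i (by simpa using hlt))
      have h1 := le_weight (w := w) (α := α) (c := c) hS
      have h3 : (2 : ℝ) ≤ α.degree := by
        exact_mod_cast hdeg j α hne fun i hi => by have := hS i hi; intro; linarith
      have h4 := hw _ (by rwa [map_add, Finsupp.degree_single]) hne
      rw [weight_add_single] at h4
      refine hj (Finset.mem_filter.2 ⟨Finset.mem_univ _, ?_⟩)
      nlinarith
  obtain ⟨j, hj⟩ := Finite.exists_min w
  refine lt_of_lt_of_le ?_ (hj i)
  by_contra hcon
  -- If the least weight were `-c ≤ 0`, there would be a weight at least `1 + 2 c`, hence one at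
  -- most `1 - 2 (1 + 2 c) = -1 - 4 c < -c`.
  have h1 := (hneg (-w j) (by linarith)).trans (hpos (1 + 2 * -w j) (by linarith))
  have h2 : 0 < (Finset.univ.filter fun i => w i ≤ - -w j).card :=
    Finset.card_pos.2 ⟨j, by simp⟩
  obtain ⟨l, hl⟩ := Finset.card_pos.1 (h2.trans_le h1)
  have h3 := (Finset.mem_filter.1 hl).2
  have h4 := hj l
  linarith

end weights

end

/-! ### Taylor expansion and finite determinacy -/

/-- Taylor expansion of a polynomial to first order. -/
theorem aeval_add_sub_mem {σ S : Type*} [Fintype σ] [CommRing S] [Algebra ℂ S] (a b : σ → S)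
    (p : MvPolynomial σ ℂ) :
    MvPolynomial.aeval (a + b) p - MvPolynomial.aeval a p -
      ∑ i, MvPolynomial.aeval a (MvPolynomial.pderiv i p) * b i ∈
        Ideal.span (Set.range b) * Ideal.span (Set.range b) := by
  classical
  have hb : ∀ i, b i ∈ Ideal.span (Set.range b) := fun i => Ideal.subset_span ⟨i, rfl⟩
  induction p using MvPolynomial.induction_on with
  | C c => simp
  | add p q hp hq =>
    convert add_mem hp hq using 1
    simp only [map_add, add_mul, Finset.sum_add_distrib]
    ring
  | mul_X p j hp =>
    have h1 : ∑ i, MvPolynomial.aeval a (MvPolynomial.pderiv i (p * MvPolynomial.X j)) * b i =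
        (∑ i, MvPolynomial.aeval a (MvPolynomial.pderiv i p) * b i) * a j +
          MvPolynomial.aeval a p * b j := by
      simp only [Derivation.leibniz, MvPolynomial.pderiv_X, smul_eq_mul, map_add, map_mul,
        MvPolynomial.aeval_X, add_mul, Finset.sum_add_distrib, Finset.sum_mul]
      rw [add_comm]
      congr 1
      · exact Finset.sum_congr rfl fun i _ => by ring
      · rw [Finset.sum_eq_single j]
        · simp
        · intro i _ hi
          simp [hi.symm]
        · simp
    rw [h1]
    set s := ∑ i, MvPolynomial.aeval a (MvPolynomial.pderiv i p) * b i with hs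
    have hsm : s * b j ∈ Ideal.span (Set.range b) * Ideal.span (Set.range b) :=
      Ideal.mul_mem_mul (sum_mem fun i _ => Ideal.mul_mem_left _ _ (hb i)) (hb j)
    convert add_mem (Ideal.mul_mem_right (a j + b j) _ hp) hsm using 1
    simp only [map_mul, MvPolynomial.aeval_X, Pi.add_apply]
    ring

theorem exists_sum_of_mem_span_mul_span {ι S : Type*} [Fintype ι] [CommRing S] (b : ι → S) {x : S}
    (I : Ideal S) (hx : x ∈ I * (Ideal.span (Set.range b) * Ideal.span (Set.range b))) :
    ∃ R : ι × ι → S, (∀ q, R q ∈ I) ∧ x = ∑ q : ι × ι, R q * (b q.1 * b q.2) := by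
  have h1 : Ideal.span (Set.range b) * Ideal.span (Set.range b) ≤
      Submodule.span S (Set.range fun q : ι × ι => b q.1 * b q.2) := by
    rw [Ideal.span_mul_span, Ideal.span_le]
    rintro _ ⟨_, ⟨i, rfl⟩, _, ⟨j, rfl⟩, rfl⟩
    exact Submodule.subset_span ⟨(i, j), rfl⟩
  have h2 := Ideal.mul_mono_right (I := I) h1 hx
  rw [← smul_eq_mul, Submodule.mem_ideal_smul_span_iff_exists_sum] at h2
  obtain ⟨R, hR, e⟩ := h2
  refine ⟨R, hR, ?_⟩
  rw [← e, Finsupp.sum_fintype _ _ (by simp)]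
  rfl

theorem conv_coe_mvPolynomial {σ : Type*} (p : MvPolynomial σ ℂ) :
    Conv (p : MvPowerSeries σ ℂ) := by
  refine ⟨1, one_pos, ?_⟩
  have e : (p : MvPowerSeries σ ℂ) = ∑ α ∈ p.support, monomial α (p.coeff α) := by
    conv_lhs => rw [p.as_sum, ← MvPolynomial.coeToMvPowerSeries.ringHom_apply, map_sum]
    simp
  rw [e]
  refine ne_top_of_le_ne_top ?_ (nrm_sum_le _ _ _)
  simp [nrm_monomial]

section

variable {n : ℕ}

theorem partialDer_ofPoly (i : Fin (n + 1)) (p : MvPolynomial (Fin (n + 1)) ℂ) :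
    partialDer i (ofPoly n p) = ofPoly n (MvPolynomial.pderiv i p) := by
  refine Subtype.ext ?_
  rw [coe_ofPoly, ← pderiv_coe, ← coe_ofPoly]
  rfl

theorem coe_aeval {ι : Type*} (g : ι → Germs n) (Q : MvPolynomial ι ℂ) :
    (MvPolynomial.aeval g Q : MvPowerSeries (Fin (n + 1)) ℂ) =
      MvPolynomial.aeval (fun i => (g i : MvPowerSeries (Fin (n + 1)) ℂ)) Q :=
  MvPolynomial.comp_aeval_apply g (convergent n).val Q

/-- Implicit functions: germs `z` with `z + Q(x, z) = h` for polynomials `Q` of order at least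
two. -/
theorem exists_add_aeval_eq {τ : Type*} [Finite τ]
    (Q : τ → MvPolynomial (Fin (n + 1) ⊕ τ) ℂ)
    (hQ : ∀ t, 2 ≤ (Q t : MvPowerSeries (Fin (n + 1) ⊕ τ) ℂ).order) (h : τ → Germs n)
    (hh : ∀ t, h t ∈ maxIdeal n) :
    ∃ z : τ → Germs n, (∀ t, z t ∈ maxIdeal n) ∧
      ∀ t, z t + MvPolynomial.aeval (Sum.elim coord z) (Q t) = h t := by
  let ℓ : Fin (n + 1) ⊕ τ → MvPowerSeries (Fin (n + 1)) ℂ := fun s =>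
    (Sum.elim coord h s : Germs n)
  -- The coordinates are adjoined as unknowns with the trivial equation `ψ = x`, so that `Q` may
  -- depend on them.
  let u : Fin (n + 1) ⊕ τ → MvPowerSeries (Fin (n + 1) ⊕ τ) ℂ :=
    Sum.elim (fun _ => 0) fun t => -(Q t : MvPowerSeries (Fin (n + 1) ⊕ τ) ℂ)
  obtain ⟨ψ, hψc, hψ0, hψ⟩ := exists_conv_fixedPoint (ℓ := ℓ) (u := u) (fun s => conv_coe _)
    (fun s => by
      rcases s with i | t
      · exact mem_maxIdeal.1 (coord_mem i)
      · exact mem_maxIdeal.1 (hh t))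
    (fun s => by
      rcases s with i | t
      · exact ⟨1, one_pos, by simp [u, nrm]⟩
      · obtain ⟨r, hr, hfin⟩ := conv_coe_mvPolynomial (Q t)
        exact ⟨r, hr, by simpa only [u, Sum.elim_inr, nrm_neg] using hfin⟩)
    (fun s => by
      rcases s with i | t
      · simp [u]
      · simpa only [u, Sum.elim_inr, order_neg] using hQ t)
  have hs : HasSubst ψ := hasSubst_of_constantCoeff_zero hψ0
  have hψinl : ∀ i, ψ (Sum.inl i) = X i := by
    intro i
    rw [hψ]
    simp only [u, ℓ, Sum.elim_inl]
    rw [← coe_substAlgHom hs, map_zero, add_zero]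
    rfl
  refine ⟨fun t => ofConv (hψc (Sum.inr t)), fun t => mem_maxIdeal.2 (hψ0 _), fun t => ?_⟩
  refine Subtype.ext ?_
  change ψ (Sum.inr t) + (MvPolynomial.aeval _ (Q t) : Germs n).1 = (h t).1
  rw [coe_aeval]
  have e : (fun s => ((Sum.elim coord (fun t => ofConv (hψc (Sum.inr t))) s : Germs n) :
      MvPowerSeries (Fin (n + 1)) ℂ)) = ψ := by
    funext s
    rcases s with i | t
    · rw [hψinl]; rfl
    · rfl
  rw [e, hψ (Sum.inr t)]
  simp only [u, ℓ, Sum.elim_inr]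
  rw [← coe_substAlgHom hs, map_neg, coe_substAlgHom, subst_coe]
  ring

/-- Finite determinacy: a sufficiently small perturbation of a polynomial whose Jacobian ideal is
`𝔪`-primary is obtained from it by a change of coordinates. -/
theorem exists_algEquiv_ofPoly_add {p : MvPolynomial (Fin (n + 1)) ℂ}
    (hp : ofPoly n p ∈ maxIdeal n ^ 2) {N : ℕ}
    (hN : maxIdeal n ^ N ≤ Ideal.span (Set.range fun i => partialDer i (ofPoly n p)))
    {h : Germs n} (hh : h ∈ maxIdeal n ^ (2 * N + 1)) :
    ∃ φ : Germs n ≃ₐ[ℂ] Germs n, φ (ofPoly n p) = ofPoly n p + h := by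
  classical
  have hJ : h ∈ maxIdeal n * (Ideal.span (Set.range fun i => partialDer i (ofPoly n p)) *
      Ideal.span (Set.range fun i => partialDer i (ofPoly n p))) := by
    rw [show 2 * N + 1 = 1 + (N + N) by ring, pow_add, pow_add, pow_one] at hh
    exact Ideal.mul_mono_right (Ideal.mul_mono hN hN) hh
  obtain ⟨H, hHm, hH⟩ := exists_sum_of_mem_span_mul_span _ _ hJ
  let ι := Fin (n + 1) ⊕ (Fin (n + 1) × Fin (n + 1))
  let x : Fin (n + 1) → MvPolynomial ι ℂ := fun i => MvPolynomial.X (Sum.inl i)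
  let z : Fin (n + 1) × Fin (n + 1) → MvPolynomial ι ℂ := fun q => MvPolynomial.X (Sum.inr q)
  let P : Fin (n + 1) → MvPolynomial ι ℂ := fun i =>
    MvPolynomial.aeval x (MvPolynomial.pderiv i p)
  -- The change of coordinates is `x_i ↦ x_i + ∑_j z_ij ∂_j p` with unknown `z`. The Taylor
  -- remainder is quadratic in `y`, so the change in `p` is `∑ ∂_i p ∂_j p (z_ij + Q_ij)` with `Q`
  -- of order two. As `h ∈ 𝔪 J ^ 2` for the Jacobian ideal `J`, it remains to solve `z + Q(x, z) =
  -- H`.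
  let y : Fin (n + 1) → MvPolynomial ι ℂ := fun i => ∑ j, P j * z (i, j)
  obtain ⟨R, -, hR⟩ := exists_sum_of_mem_span_mul_span y ⊤
    (by rw [Ideal.top_mul]; exact aeval_add_sub_mem x y p)
  let Q : Fin (n + 1) × Fin (n + 1) → MvPolynomial ι ℂ := fun q =>
    ∑ r : Fin (n + 1) × Fin (n + 1), R r * (z (r.1, q.1) * z (r.2, q.2))
  have hTaylor : MvPolynomial.aeval (x + y) p = MvPolynomial.aeval x p +
      ∑ q : Fin (n + 1) × Fin (n + 1), P q.1 * P q.2 * (z q + Q q) := by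
    have h1 : ∑ r : Fin (n + 1) × Fin (n + 1), R r * (y r.1 * y r.2) =
        ∑ q : Fin (n + 1) × Fin (n + 1), P q.1 * P q.2 * Q q := by
      simp only [Q, Finset.mul_sum]
      rw [Finset.sum_comm]
      refine Finset.sum_congr rfl fun r _ => ?_
      simp only [y]
      rw [Finset.sum_mul_sum, Finset.mul_sum, Fintype.sum_prod_type]
      refine Finset.sum_congr rfl fun i _ => ?_
      rw [Finset.mul_sum]
      refine Finset.sum_congr rfl fun j _ => ?_
      ring
    have h2 : ∑ i, P i * y i = ∑ q : Fin (n + 1) × Fin (n + 1), P q.1 * P q.2 * z q := by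
      rw [Fintype.sum_prod_type]
      refine Finset.sum_congr rfl fun i _ => ?_
      simp only [y, Finset.mul_sum]
      refine Finset.sum_congr rfl fun j _ => ?_
      ring
    simp only [mul_add, Finset.sum_add_distrib]
    rw [← h1, ← h2, ← hR]
    ring
  have hXord : ∀ s : ι, ((1 : ℕ) : ℕ∞) ≤ (X s : MvPowerSeries ι ℂ).order := fun s => by
    exact_mod_cast one_le_order_iff_constCoeff_eq_zero.2 (constantCoeff_X s)
  have hQord : ∀ q, 2 ≤ (Q q : MvPowerSeries ι ℂ).order := by
    intro q
    rw [← MvPolynomial.coeToMvPowerSeries.ringHom_apply, map_sum]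
    refine Finset.sum_induction _ (fun F : MvPowerSeries ι ℂ => ((2 : ℕ) : ℕ∞) ≤ F.order)
      (fun a b ha hb => le_order_add_of_le ha hb) (by simp) fun r _ => ?_
    rw [map_mul, map_mul]
    refine le_order_mul_of_le (a := 0) (b := 1 + 1) (by simp) (le_order_mul_of_le ?_ ?_)
    · simpa [z] using hXord (Sum.inr (r.1, q.1))
    · simpa [z] using hXord (Sum.inr (r.2, q.2))
  obtain ⟨Z, hZm, hZ⟩ := exists_add_aeval_eq Q hQord H hHm
  set g : ι → Germs n := Sum.elim coord Z with hg
  have hgx : ∀ q : MvPolynomial (Fin (n + 1)) ℂ,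
      MvPolynomial.aeval g (MvPolynomial.aeval x q) = ofPoly n q := by
    intro q
    rw [MvPolynomial.comp_aeval_apply, ofPoly]
    congr 2
    funext i
    simp [x, g]
  have hgP : ∀ i, MvPolynomial.aeval g (P i) = partialDer i (ofPoly n p) := by
    intro i
    rw [hgx, partialDer_ofPoly]
  have hgz : ∀ q, MvPolynomial.aeval g (z q) = Z q := by
    intro q
    simp [z, g]
  set Y : Fin (n + 1) → Germs n := fun i => MvPolynomial.aeval g (y i) with hY
  have hY2 : ∀ i, Y i ∈ maxIdeal n ^ 2 := by
    intro i
    simp only [hY, y, map_sum, map_mul]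
    refine sum_mem fun j _ => ?_
    rw [hgP, hgz, pow_two]
    refine Ideal.mul_mem_mul ?_ (hZm _)
    have := derivation_mem_pow (partialDer j) (k := 1) hp
    rwa [pow_one] at this
  obtain ⟨φ, hφ⟩ := exists_algEquiv (fun i => coord i + Y i)
    (fun i => add_mem (coord_mem i) (Ideal.pow_le_self two_ne_zero (hY2 i))) (by
      have : jac (fun i => coord i + Y i) = 1 := by
        ext i j
        rw [jac, Matrix.of_apply, map_add, cf_single_of_mem_sq (hY2 i), cf_single_coord,
          Matrix.one_apply, add_zero]
        simp only [eq_comm]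
      rw [this]
      exact isUnit_one)
  refine ⟨φ, ?_⟩
  have h1 : φ (ofPoly n p) = MvPolynomial.aeval g (MvPolynomial.aeval (x + y) p) := by
    rw [MvPolynomial.comp_aeval_apply, ofPoly]
    rw [← AlgEquiv.coe_toAlgHom, MvPolynomial.comp_aeval_apply]
    congr 2
    funext i
    simp [hφ, x, g, hY]
  rw [h1, hTaylor, map_add, hgx, map_sum, hH]
  congr 1
  refine Finset.sum_congr rfl fun q _ => ?_
  rw [map_mul, map_mul, map_add, hgP, hgP, hgz, hZ, mul_comm]

end

/-! ### Rational weights -/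

/-- On the finite-dimensional `ℚ`-span of the weights, approximate the inclusion into `ℝ` by a
`ℚ`-valued linear form still positive on each `w i`. Linearity preserves all integral relations;
then clear denominators. -/
theorem exists_nat_weights {ι : Type*} [Finite ι] {w : ι → ℝ} (hw : ∀ i, 0 < w i) :
    ∃ v : ι → ℕ, (∀ i, 0 < v i) ∧ ∀ c : ι →₀ ℤ, c.sum (fun i e => (e : ℝ) * w i) = 0 →
      c.sum (fun i e => e * (v i : ℤ)) = 0 := by
  classical
  cases nonempty_fintype ι
  let V := Submodule.span ℚ (Set.range w)
  have : FiniteDimensional ℚ V := FiniteDimensional.span_of_finite ℚ (Set.finite_range w)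
  let b := Module.finBasis ℚ V
  let w' : ι → V := fun i => ⟨w i, Submodule.subset_span ⟨i, rfl⟩⟩
  let F : (Fin (Module.finrank ℚ V) → ℝ) → ι → ℝ := fun q i => ∑ j, (b.repr (w' i) j : ℝ) * q j
  have hFb : F (fun j => (b j : ℝ)) = w := by
    funext i
    have h1 := congrArg (Subtype.val : V → ℝ) (b.sum_repr (w' i))
    rw [Submodule.coe_sum] at h1
    rw [← show ((w' i : V) : ℝ) = w i from rfl, ← h1]
    exact Finset.sum_congr rfl fun j _ => (Rat.smul_def _ _).symm
  have hFc : Continuous F := by fun_prop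
  have hopen : IsOpen {q | ∀ i, 0 < F q i} := by
    simp only [Set.ofPred_forall]
    exact isOpen_iInter_of_finite fun i =>
      isOpen_lt continuous_const ((continuous_apply i).comp hFc)
  have hdense : DenseRange (fun (q : Fin (Module.finrank ℚ V) → ℚ) (j : Fin _) => (q j : ℝ)) :=
    DenseRange.piMap fun _ => Rat.denseRange_cast
  obtain ⟨q, hq⟩ := hdense.exists_mem_open hopen
    ⟨fun j => (b j : ℝ), fun i => by rw [hFb]; exact hw i⟩
  let T : V →ₗ[ℚ] ℚ := b.constr ℚ q
  have hT : ∀ i, 0 < T (w' i) := by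
    intro i
    have h1 : ((T (w' i) : ℚ) : ℝ) = F (fun j => (q j : ℝ)) i := by
      simp only [T, F, Module.Basis.constr_apply_fintype, Module.Basis.equivFun_apply, smul_eq_mul,
        Rat.cast_sum, Rat.cast_mul]
    have h2 : (0 : ℝ) < ((T (w' i) : ℚ) : ℝ) := by rw [h1]; exact hq i
    exact_mod_cast h2
  set D : ℕ := ∏ i, (T (w' i)).den with hD
  have hD0 : 0 < D := Finset.prod_pos fun i _ => (T (w' i)).den_pos
  have hv : ∀ i, ∃ v : ℕ, (v : ℚ) = D * T (w' i) := by
    intro i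
    obtain ⟨e, he⟩ := Finset.dvd_prod_of_mem (fun i => (T (w' i)).den) (Finset.mem_univ i)
    refine ⟨e * (T (w' i)).num.toNat, ?_⟩
    have h1 : (((T (w' i)).num.toNat : ℤ) : ℚ) = (T (w' i)).num := by
      rw [Int.toNat_of_nonneg (Rat.num_nonneg.2 (hT i).le)]
    rw [Int.cast_natCast] at h1
    rw [Nat.cast_mul, h1, hD, he, Nat.cast_mul]
    have h2 := Rat.mul_den_eq_num (T (w' i))
    rw [← h2]
    ring
  choose v hv using hv
  refine ⟨v, fun i => ?_, fun c hc => ?_⟩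
  · have : (0 : ℚ) < v i := by
      rw [hv]
      exact mul_pos (by exact_mod_cast hD0) (hT i)
    exact_mod_cast this
  · rw [Finsupp.sum_fintype _ _ (by simp)] at hc ⊢
    have h1 : ∑ i, (c i : ℚ) • w' i = 0 := by
      refine Subtype.ext ?_
      rw [Submodule.coe_sum, Submodule.coe_zero, ← hc]
      refine Finset.sum_congr rfl fun i _ => ?_
      rw [Submodule.coe_smul, Rat.smul_def, Rat.cast_intCast]
    have h2 := congrArg T h1
    rw [map_sum, map_zero] at h2
    have h3 : ((∑ i, c i * (v i : ℤ) : ℤ) : ℚ) = 0 := by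
      rw [Int.cast_sum]
      calc ∑ i, ((c i * (v i : ℤ) : ℤ) : ℚ) = D * ∑ i, T ((c i : ℚ) • w' i) := by
            rw [Finset.mul_sum]
            refine Finset.sum_congr rfl fun i _ => ?_
            rw [map_smul, smul_eq_mul, Int.cast_mul, Int.cast_natCast, hv]
            ring
        _ = 0 := by rw [h2, mul_zero]
    exact_mod_cast h3

/-! ### Generalised inverses -/

/-- Take a linear section of `H` over its range and extend it to the whole space. -/
theorem exists_generalized_inverse {m : Type*} [Fintype m] [DecidableEq m] (H : Matrix m m ℂ) :
    ∃ G : Matrix m m ℂ, H * G * H = H := by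
  set f := Matrix.toLin' H with hf
  obtain ⟨g₀, hg₀⟩ := f.rangeRestrict.exists_rightInverse_of_surjective
    (LinearMap.range_eq_top.2 f.surjective_rangeRestrict)
  obtain ⟨g, hg⟩ := LinearMap.exists_extend g₀
  refine ⟨LinearMap.toMatrix' g, Matrix.toLin'.injective ?_⟩
  rw [Matrix.toLin'_mul, Matrix.toLin'_mul, Matrix.toLin'_toMatrix', ← hf]
  refine LinearMap.ext fun v => ?_
  have h1 : g (f v) = g₀ (f.rangeRestrict v) := by
    rw [← hg]; rfl
  have h2 := congrArg Subtype.val (DFunLike.congr_fun hg₀ (f.rangeRestrict v))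
  change f (g (f v)) = f v
  rw [h1]
  exact h2

/-- If `Mᵀ H + H M = H` with `H` symmetric, then `M` can be changed by a matrix `A H` with `A`
antisymmetric so as to become one half on the row space of `H`. -/
theorem exists_antisymm_correction {m : Type*} [Fintype m] [DecidableEq m] {H M : Matrix m m ℂ}
    (hH : H.transpose = H) (hM : M.transpose * H + H * M = H) :
    ∃ A : Matrix m m ℂ, A.transpose = -A ∧ H * (M + A * H) = (1 / 2 : ℂ) • H := by
  obtain ⟨G, hG⟩ := exists_generalized_inverse H
  set K := (1 / 2 : ℂ) • (1 : Matrix m m ℂ) - M with hK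
  set S := H * K with hS
  have hHK : S = (1 / 2 : ℂ) • H - H * M := by
    rw [hS, hK, Matrix.mul_sub, Matrix.mul_smul, Matrix.mul_one]
  have hST : S.transpose = -S := by
    rw [hHK, Matrix.transpose_sub, Matrix.transpose_smul, Matrix.transpose_mul, hH,
      eq_sub_of_add_eq hM]
    have : H = (1 / 2 : ℂ) • H + (1 / 2 : ℂ) • H := by
      rw [← add_smul]; norm_num
    nth_rewrite 2 [this]
    abel
  have h1 : H * G * S = S := by rw [hS, ← Matrix.mul_assoc, hG]
  clear_value S
  have h2 : S * G.transpose * H = S := by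
    have h3 := congrArg Matrix.transpose h1
    rw [Matrix.transpose_mul, Matrix.transpose_mul, hH, hST, Matrix.neg_mul, neg_inj,
      ← Matrix.mul_assoc] at h3
    exact h3
  -- The equation to solve is `H A H = S` with `S = H / 2 - H M` antisymmetric; the generalised
  -- inverse solves it while keeping antisymmetry.
  refine ⟨G * S * G.transpose, ?_, ?_⟩
  · rw [Matrix.transpose_mul, Matrix.transpose_mul, Matrix.transpose_transpose, hST,
      Matrix.neg_mul, Matrix.mul_neg, Matrix.mul_assoc]
  · have h4 : H * (G * S * G.transpose * H) = S := by
      calc H * (G * S * G.transpose * H) = (H * G * S) * G.transpose * H := by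
            simp only [Matrix.mul_assoc]
        _ = S := by rw [h1, h2]
    rw [Matrix.mul_add, h4, hHK]
    abel

section

variable {n : ℕ}

theorem partialDer_mem {f : Germs n} (hf : f ∈ maxIdeal n ^ 2) (i : Fin (n + 1)) :
    partialDer i f ∈ maxIdeal n := by
  have := derivation_mem_pow (partialDer i) (k := 1) hf
  rwa [pow_one] at this

/-! ### Vector fields of weight one half on the quadratic part -/

/-- `δ` acts as multiplication by one half on the linear parts of the partial derivatives. -/
def IsHalf (δ : VectorFields n) (f : Germs n) : Prop :=
  ∀ i, shift δ (1 / 2) (partialDer i f) ∈ maxIdeal n ^ 2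

theorem derivation_mem_of_coord {δ : VectorFields n} (hδ : ∀ i, δ (coord i) ∈ maxIdeal n)
    (g : Germs n) : δ g ∈ maxIdeal n := by
  rw [derivation_apply]
  exact sum_mem fun i _ => Ideal.mul_mem_right _ _ (hδ i)

/-- Allowing arbitrary `D` makes the condition independent of coordinates, as conjugation by an
automorphism requires. -/
theorem IsHalf.derivation {δ : VectorFields n} {f : Germs n}
    (hδ : ∀ i, δ (coord i) ∈ maxIdeal n) (hf : f ∈ maxIdeal n ^ 2) (h : IsHalf δ f)
    (D : VectorFields n) : shift δ (1 / 2) (D f) ∈ maxIdeal n ^ 2 := by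
  rw [derivation_apply, map_sum]
  refine sum_mem fun i _ => ?_
  have e : shift δ (1 / 2) (D (coord i) * partialDer i f) =
      D (coord i) * shift δ (1 / 2) (partialDer i f) + δ (D (coord i)) * partialDer i f := by
    rw [shift_apply, shift_apply, Derivation.leibniz, smul_eq_mul, smul_eq_mul, mul_sub,
      mul_smul_comm]
    ring
  rw [e]
  refine add_mem (Ideal.mul_mem_left _ _ (h i)) ?_
  rw [pow_two]
  exact Ideal.mul_mem_mul (derivation_mem_of_coord hδ _) (partialDer_mem hf i)

theorem IsHalf.conjDer {δ : VectorFields n} {f : Germs n}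
    (hδ : ∀ i, δ (coord i) ∈ maxIdeal n) (hf : f ∈ maxIdeal n ^ 2) (h : IsHalf δ f)
    (φ : Germs n ≃ₐ[ℂ] Germs n) : IsHalf (conjDer φ δ) (φ f) := by
  intro i
  have h1 := h.derivation hδ hf (LogVF.conjDer φ.symm (partialDer i))
  have h2 := algHom_mem_maxIdeal_pow (φ : Germs n →ₐ[ℂ] Germs n) h1
  have h3 : (φ : Germs n →ₐ[ℂ] Germs n)
      (shift δ (1 / 2) (LogVF.conjDer φ.symm (partialDer i) f)) =
      shift (LogVF.conjDer φ δ) (1 / 2) (partialDer i (φ f)) := by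
    change φ _ = _
    rw [shift_apply, shift_apply, map_sub, map_smul, conjDer_apply, conjDer_apply,
      AlgEquiv.symm_symm, AlgEquiv.apply_symm_apply]
  rwa [h3] at h2

theorem IsHalf.mul {δ : VectorFields n} {f : Germs n}
    (hδ : ∀ i, δ (coord i) ∈ maxIdeal n) (hf : f ∈ maxIdeal n ^ 2) (h : IsHalf δ f)
    (u : Germs n) : IsHalf δ (u * f) := by
  intro i
  have e : shift δ (1 / 2) (partialDer i (u * f)) =
      u * shift δ (1 / 2) (partialDer i f) + δ u * partialDer i f +
        shift δ (1 / 2) (f * partialDer i u) := by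
    simp only [shift_apply, Derivation.leibniz, map_add, smul_eq_mul, Algebra.smul_def]
    ring
  rw [e]
  refine add_mem (add_mem (Ideal.mul_mem_left _ _ (h i)) ?_)
    (shift_mem_pow hδ _ (Ideal.mul_mem_right _ _ hf))
  rw [pow_two]
  exact Ideal.mul_mem_mul (derivation_mem_of_coord hδ _) (partialDer_mem hf i)

/-- For the Hessian `H` and the linear part `M`, the quadratic terms of `δ f = a f` say `Mᵀ H + H M
= H`. Subtracting `θ = ∑ A_ij ∂_i f ∂_j` with `A` antisymmetric leaves `δ f` unchanged and turns `M`
into `M + A H`, so `exists_antisymm_correction` applies. -/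
theorem exists_isHalf {δ : VectorFields n} {f a : Germs n} (hf : f ∈ maxIdeal n ^ 2)
    (hδ : ∀ i, δ (coord i) ∈ maxIdeal n) (ha : δ f = a * f) (ha1 : evalZero n a = 1) :
    ∃ ε : VectorFields n, (∀ i, ε (coord i) ∈ maxIdeal n) ∧ ε f = a * f ∧ IsHalf ε f := by
  classical
  set M := linearPart δ with hM
  set H := jac fun i => partialDer i f with hHdef
  have hHapp : ∀ i j, H i j = cf (Finsupp.single j 1) (partialDer i f) := fun i j => rfl
  have hHsymm : ∀ i j, H i j = H j i := by
    intro i j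
    rw [hHapp, hHapp, ← evalZero_partialDer, ← evalZero_partialDer, partialDer_comm]
  have hH : H.transpose = H := by
    ext i j
    exact hHsymm j i
  have hrel : M.transpose * H + H * M = H := by
    ext l j
    have h1 : partialDer l (δ f) = ∑ i, (partialDer l (δ (coord i)) * partialDer i f +
        δ (coord i) * partialDer l (partialDer i f)) := by
      rw [derivation_apply δ f, map_sum]
      refine Finset.sum_congr rfl fun i _ => ?_
      rw [Derivation.leibniz, smul_eq_mul, smul_eq_mul]
      ring
    have h2 : partialDer l (δ f) = a * partialDer l f + f * partialDer l a := by
      rw [ha, Derivation.leibniz, smul_eq_mul, smul_eq_mul]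
    have h3 := congrArg (cf (Finsupp.single j 1)) (h1.symm.trans h2)
    simp only [map_sum, map_add, cf_single_mul] at h3
    simp only [evalZero_partialDer, mem_maxIdeal.1 (hδ _), cf_single_of_mem_sq hf,
      mem_maxIdeal.1 (Ideal.pow_le_self two_ne_zero hf), ha1, zero_mul, one_mul, add_zero,
      mul_zero, zero_add] at h3
    rw [Matrix.add_apply, Matrix.mul_apply, Matrix.mul_apply, ← Finset.sum_add_distrib, hHapp,
      ← h3]
    refine Finset.sum_congr rfl fun i _ => ?_
    rw [Matrix.transpose_apply, hHsymm l i]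
    rfl
  obtain ⟨A, hA, hAH⟩ := exists_antisymm_correction hH hrel
  let θ : VectorFields n := ∑ i, ∑ j, (A i j • partialDer i f) • partialDer j
  have hθ : ∀ g, θ g = ∑ i, ∑ j, A i j • (partialDer i f * partialDer j g) := by
    intro g
    simp only [θ, derivation_sum_apply, Derivation.smul_apply, smul_eq_mul, smul_mul_assoc]
  have hθf : θ f = 0 := by
    have h1 : θ f = -θ f := by
      conv_lhs => rw [hθ, Finset.sum_comm]
      rw [hθ, ← Finset.sum_neg_distrib]
      refine Finset.sum_congr rfl fun i _ => ?_
      rw [← Finset.sum_neg_distrib]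
      refine Finset.sum_congr rfl fun j _ => ?_
      have h2 : A j i = -A i j := by
        have := congrFun (congrFun hA i) j
        simpa using this
      rw [h2, neg_smul, mul_comm]
    have h2 : (2 : ℂ) • θ f = 0 := by
      rw [two_smul]
      nth_rewrite 1 [h1]
      exact neg_add_cancel _
    exact (smul_eq_zero.1 h2).resolve_left two_ne_zero
  have hθcoord : ∀ l, θ (coord l) = ∑ i, A i l • partialDer i f := by
    intro l
    rw [hθ]
    refine Finset.sum_congr rfl fun i _ => ?_
    rw [Finset.sum_eq_single l]
    · simp [partialDer_coord]
    · intro j _ hj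
      simp [partialDer_coord, hj.symm]
    · simp
  have hε : ∀ i, (δ - θ) (coord i) ∈ maxIdeal n := by
    intro i
    rw [Derivation.sub_apply, hθcoord]
    refine sub_mem (hδ i) (sum_mem fun j _ => ?_)
    rw [Algebra.smul_def]
    exact Ideal.mul_mem_left _ _ (partialDer_mem hf j)
  have hlin : linearPart (δ - θ) = M + A * H := by
    ext l j
    rw [linearPart_apply, Derivation.sub_apply, map_sub, hθcoord, map_sum, Matrix.add_apply,
      Matrix.mul_apply, sub_eq_add_neg, ← Finset.sum_neg_distrib]
    congr 1
    refine Finset.sum_congr rfl fun i _ => ?_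
    have h2 : A i l = -A l i := by
      have := congrFun (congrFun hA l) i
      simpa using this
    rw [map_smul, h2, smul_eq_mul, neg_mul, neg_neg]
    rfl
  refine ⟨δ - θ, hε, by rw [Derivation.sub_apply, hθf, sub_zero, ha], fun l => ?_⟩
  refine mem_sq_of_cf (sub_mem (derivation_mem_of_coord hε _) ?_) fun j => ?_
  · change (1 / 2 : ℂ) • partialDer l f ∈ _
    rw [Algebra.smul_def]
    exact Ideal.mul_mem_left _ _ (partialDer_mem hf l)
  · rw [shift_apply, map_sub, cf_single_derivation hε, hlin, map_smul, sub_eq_zero]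
    exact congrFun (congrFun hAH l) j

theorem IsHalf.weight_eq {δ : VectorFields n} {f : Germs n}
    (hδ : ∀ i, δ (coord i) ∈ maxIdeal n) (h : IsHalf δ f) {k : ℕ} (hk : 2 ≤ k)
    {w : Fin (n + 1) → ℂ} (hw : ∀ i, IsGen δ k (w i) (coord i)) {i j : Fin (n + 1)}
    (hne : cf (Finsupp.single i 1 + Finsupp.single j 1) f ≠ 0) : w i = 1 / 2 := by
  classical
  have h1 : IsGen δ 2 (1 / 2) (partialDer j f) := ⟨1, by rw [pow_one]; exact h j⟩
  have h2 := h1.weight_eq hδ (fun i => (hw i).mono hk) (α := Finsupp.single i 1) (by simp) (by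
    rw [cf_partialDer]
    exact mul_ne_zero hne (Nat.cast_add_one_ne_zero _))
  rw [← h2]
  simp [Finsupp.single_apply]

/-! ### Normal form and conclusion -/

theorem exists_normalForm {δ : VectorFields n} (hδ : ∀ i, δ (coord i) ∈ maxIdeal n)
    {f a : Germs n} (ha : δ f = a * f) {k : ℕ} (hk : 2 ≤ k) (hf : f ∉ maxIdeal n ^ k) :
    ∃ (φ : Germs n ≃ₐ[ℂ] Germs n) (u : (Germs n)ˣ) (w : Fin (n + 1) → ℂ),
      IsUnit (jac fun i => φ.symm (coord i)) ∧
      (∀ i, IsGen (conjDer φ δ) k (w i) (coord i)) ∧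
      IsGen (conjDer φ δ) k (evalZero n a) (φ (u * f)) := by
  obtain ⟨y, w, hy, hdet, hw⟩ := exists_isGen_coordinates hδ hk
  obtain ⟨ψ, hψ⟩ := exists_algEquiv y hy hdet
  obtain ⟨u, hu⟩ := exists_unit_isGen hδ ha hf
  refine ⟨ψ.symm, u, w, ?_, fun i => ?_, hu.conjDer _⟩
  · rw [AlgEquiv.symm_symm]
    simpa only [hψ] using hdet
  · have := (hw i).conjDer ψ.symm
    rwa [← hψ, AlgEquiv.symm_apply_apply] at this

/-- Otherwise the Tjurina ideal would lie in `𝔪 ^ (k - 1)`, which does not contain `𝔪 ^ N`. -/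
theorem not_mem_maxIdeal_pow {f : Germs n} {N k : ℕ} (hN : maxIdeal n ^ N ≤ tjurina f)
    (hk : N + 2 ≤ k) : f ∉ maxIdeal n ^ k := by
  intro hf
  obtain ⟨l, rfl⟩ : ∃ l, k = l + 1 := ⟨k - 1, by omega⟩
  refine not_maxIdeal_pow_le (n := n) (show N < l by omega) (hN.trans ?_)
  exact tjurina_le.2 ⟨Ideal.pow_le_pow_right (Nat.le_succ l) hf, fun i =>
    derivation_mem_pow _ hf⟩

theorem trace_eq_zero {f a : Germs n} (hf : f ∈ maxIdeal n ^ 2) {N : ℕ}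
    (hN : maxIdeal n ^ N ≤ tjurina f) {δ : VectorFields n}
    (hδ : ∀ i, δ (coord i) ∈ maxIdeal n) (ha : δ f = a * f) (ha0 : evalZero n a = 0) :
    (linearPart δ).trace = 0 := by
  obtain ⟨φ, u, w, hdet, hw, hfw⟩ := exists_normalForm hδ ha (k := N + 2) (by omega)
    (not_mem_maxIdeal_pow hN le_rfl)
  have hδ' := conjDer_coord_mem φ hδ
  rw [← trace_linearPart_conjDer φ hδ hdet, trace_linearPart_eq_sum hδ' (by omega) hw]
  have hf' : φ (u * f) ∈ maxIdeal n ^ 2 :=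
    algHom_mem_maxIdeal_pow (φ : Germs n →ₐ[ℂ] Germs n) (Ideal.mul_mem_left _ _ hf)
  have hN' := pow_le_tjurina_map (pow_le_tjurina_mul hN u) φ
  rw [ha0] at hfw
  -- The relations have natural coefficients and right-hand side zero, so real and imaginary parts
  -- of the weights satisfy them separately.
  refine Complex.ext ?_ ?_
  · rw [Complex.re_sum]
    refine sum_weight_eq_zero hf' hN' le_rfl fun α hα hne => ?_
    have := congrArg Complex.re (hfw.weight_eq hδ' hw hα hne)
    simpa [Complex.re_sum] using this
  · rw [Complex.im_sum]
    refine sum_weight_eq_zero hf' hN' le_rfl fun α hα hne => ?_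
    have := congrArg Complex.im (hfw.weight_eq hδ' hw hα hne)
    simpa [Complex.im_sum] using this

/-- This puts `g` in its own Jacobian ideal, as needed to pass from the Tjurina ideal to the ideal
of the partial derivatives. -/
theorem euler {g : Germs n} {w : Fin (n + 1) → ℂ}
    (h : ∀ α : Fin (n + 1) →₀ ℕ, cf α g ≠ 0 → ∑ i, α i * w i = 1) :
    g = ∑ i, (w i • coord i) * partialDer i g := by
  refine germ_ext fun m => ?_
  have h1 : ∀ i, cf m ((w i • coord i) * partialDer i g) = (m i * w i) * cf m g := by
    intro i
    rw [smul_mul_assoc, map_smul, cf_coord_mul]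
    split_ifs with h0
    · simp [h0]
    · have h2 : Finsupp.single i 1 ≤ m := by
        rw [Finsupp.single_le_iff]; exact Nat.one_le_iff_ne_zero.2 h0
      rw [cf_partialDer, tsub_add_cancel_of_le h2, Finsupp.tsub_apply, Finsupp.single_eq_same,
        Nat.cast_sub (Nat.one_le_iff_ne_zero.2 h0), Nat.cast_one, sub_add_cancel, smul_eq_mul]
      ring
  rw [map_sum]
  simp_rw [h1]
  rw [← Finset.sum_mul]
  by_cases h0 : cf m g = 0
  · simp [h0]
  · rw [h m h0, one_mul]

/-- Saito's theorem: an isolated singularity whose equation is multiplied by a unit by some vector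
field is quasihomogeneous. -/
theorem isQuasihomogeneous_of_evalZero_ne_zero {f a : Germs n} (hf : f ∈ maxIdeal n ^ 2) {N : ℕ}
    (hN : maxIdeal n ^ N ≤ tjurina f) {δ : VectorFields n}
    (hδ : ∀ i, δ (coord i) ∈ maxIdeal n) (ha : δ f = a * f) (ha0 : evalZero n a ≠ 0) :
    IsQuasihomogeneous f := by
  obtain ⟨ε, hε, hεf, hhalf⟩ := exists_isHalf (δ := (evalZero n a)⁻¹ • δ)
    (a := (evalZero n a)⁻¹ • a) hf (fun i => by
      rw [Derivation.smul_apply, Algebra.smul_def]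
      exact Ideal.mul_mem_left _ _ (hδ i))
    (by rw [Derivation.smul_apply, ha, smul_mul_assoc]) (by
      rw [evalZero_smul, inv_mul_cancel₀ ha0])
  -- With `k = 2 N + 2` the truncation error and its derivatives lie in `𝔪 ^ (2 N + 1)`, which
  -- serves finite determinacy as well as Nakayama.
  obtain ⟨φ, u, w, -, hw, hfw⟩ := exists_normalForm hε hεf (k := 2 * N + 2) (by omega)
    (not_mem_maxIdeal_pow hN (by omega))
  rw [evalZero_smul, inv_mul_cancel₀ ha0] at hfw
  have hε' := conjDer_coord_mem φ hε
  have hf' : φ (u * f) ∈ maxIdeal n ^ 2 :=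
    algHom_mem_maxIdeal_pow (φ : Germs n →ₐ[ℂ] Germs n) (Ideal.mul_mem_left _ _ hf)
  have hN' := pow_le_tjurina_map (pow_le_tjurina_mul hN u) φ
  have hhalf' : IsHalf (conjDer φ ε) (φ (u * f)) :=
    (hhalf.mul hε hf u).conjDer hε (Ideal.mul_mem_left _ _ hf) φ
  set F : Germs n := φ (u * f) with hF
  have hweight : ∀ α : Fin (n + 1) →₀ ℕ, α.degree < 2 * N + 2 → cf α F ≠ 0 →
      ∑ i, α i * w i = 1 := fun α hα hne => hfw.weight_eq hε' hw hα hne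
  have hre : ∀ α : Fin (n + 1) →₀ ℕ, α.degree < 2 * N + 2 → cf α F ≠ 0 →
      ∑ i, α i * (w i).re = 1 := by
    intro α hα hne
    have := congrArg Complex.re (hweight α hα hne)
    simpa [Complex.re_sum] using this
  have hpos : ∀ i, 0 < (w i).re := weight_pos hf' hN' (by omega) hre fun i j hne => by
    rw [hhalf'.weight_eq hε' (by omega) hw hne]
    norm_num
  set p := jet (2 * N + 2) F with hp
  have hsupp : ∀ α : Fin (n + 1) →₀ ℕ, p.coeff α ≠ 0 → α.degree < 2 * N + 2 ∧ cf α F ≠ 0 := by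
    intro α hα
    rw [hp, coeff_jet] at hα
    by_cases hd : α.degree < 2 * N + 2
    · rw [if_pos hd] at hα
      exact ⟨hd, hα⟩
    · rw [if_neg hd] at hα
      exact (hα rfl).elim
  have hrem := sub_ofPoly_jet_mem (2 * N + 2) F
  rw [← hp] at hrem
  have hp2 : ofPoly n p ∈ maxIdeal n ^ 2 := by
    have h1 : F - ofPoly n p ∈ maxIdeal n ^ 2 := Ideal.pow_le_pow_right (by omega) hrem
    simpa using sub_mem hf' h1
  set J := Ideal.span (Set.range fun i => partialDer i (ofPoly n p)) with hJ
  have hpJ : ofPoly n p ∈ J := by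
    rw [euler (g := ofPoly n p) (w := w) fun α hα => by
      rw [cf_ofPoly] at hα
      exact hweight α (hsupp α hα).1 (hsupp α hα).2]
    exact sum_mem fun i _ => Ideal.mul_mem_left _ _ (Ideal.subset_span ⟨i, rfl⟩)
  have hJN : maxIdeal n ^ N ≤ J := by
    refine maxIdeal_pow_le_of_le_sup (k := 2 * N + 1) (by omega) (hN'.trans ?_)
    rw [tjurina_le]
    refine ⟨?_, fun i => ?_⟩
    · rw [← add_sub_cancel (ofPoly n p) F]
      exact Submodule.add_mem_sup hpJ (Ideal.pow_le_pow_right (by omega) hrem)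
    · rw [← add_sub_cancel (ofPoly n p) F, map_add]
      exact Submodule.add_mem_sup (Ideal.subset_span ⟨i, rfl⟩) (derivation_mem_pow _ hrem)
  obtain ⟨ψ, hψ⟩ := exists_algEquiv_ofPoly_add hp2 hJN
    (Ideal.pow_le_pow_right (by omega) hrem : F - ofPoly n p ∈ maxIdeal n ^ (2 * N + 1))
  rw [add_sub_cancel] at hψ
  obtain ⟨v, hv, hvc⟩ := exists_nat_weights hpos
  obtain ⟨r, hr⟩ : ∃ r, ∀ α : Fin (n + 1) →₀ ℕ, p.coeff α ≠ 0 → ∑ i, α i * v i = r := by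
    by_cases hex : ∃ β : Fin (n + 1) →₀ ℕ, p.coeff β ≠ 0
    · obtain ⟨β, hβ⟩ := hex
      refine ⟨∑ i, β i * v i, fun α hα => ?_⟩
      have h1 := hre α (hsupp α hα).1 (hsupp α hα).2
      have h2 := hre β (hsupp β hβ).1 (hsupp β hβ).2
      -- The difference of two exponents of `p` is an integral relation among the real weights,
      -- hence among the integer weights.
      have h3 := hvc (Finsupp.equivFunOnFinite.symm fun i => (α i : ℤ) - β i) (by
        rw [Finsupp.sum_fintype _ _ (by simp)]
        simp only [Finsupp.equivFunOnFinite_symm_apply_apply, Int.cast_sub, Int.cast_natCast,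
          sub_mul, Finset.sum_sub_distrib, h1, h2, sub_self])
      rw [Finsupp.sum_fintype _ _ (by simp)] at h3
      simp only [Finsupp.equivFunOnFinite_symm_apply_apply, sub_mul, Finset.sum_sub_distrib,
        sub_eq_zero] at h3
      exact_mod_cast h3
    · exact ⟨0, fun α hα => (hex ⟨α, hα⟩).elim⟩
  refine ⟨φ.trans ψ.symm, u, v, r, p, hv, fun α hα => ?_, ?_⟩
  · rw [← hr α hα, Finsupp.weight_apply, Finsupp.sum_fintype _ _ (by simp)]
    rfl
  · rw [AlgEquiv.trans_apply, ← hF, ← hψ, AlgEquiv.symm_apply_apply, coe_ofPoly]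

end

end LogVF

end

theorem mainTheorem3 (n : ℕ) (f : LogVF.Germs n) (hord : f ∈ LogVF.maxIdeal n ^ 2)
    (hiso : LogVF.IsIsolatedSingularity f) (hqh : ¬ LogVF.IsQuasihomogeneous f) :
    ∀ δ ∈ LogVF.logDer f,
      δ ∈ LogVF.vanishingDer n ∧ (LogVF.linearPart δ).trace = 0 := by
  intro δ hδ
  obtain ⟨N, hN⟩ := hiso.exists_pow_le
  have hcoord := LogVF.logDer_coord_mem hord hN hδ
  obtain ⟨a, ha⟩ := Ideal.mem_span_singleton'.1 (show δ f ∈ Ideal.span {f} from hδ)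
  refine ⟨LogVF.mem_vanishingDer hcoord, ?_⟩
  -- A nonzero value of `a` at the origin would make `D` quasihomogeneous.
  by_cases ha0 : LogVF.evalZero n a = 0
  · exact LogVF.trace_eq_zero hord hN hcoord ha.symm ha0
  · exact (hqh (LogVF.isQuasihomogeneous_of_evalZero_ne_zero hord hN hcoord ha.symm ha0)).elim
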